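/- Let $A$ be a commutative ring and $\phi\colon H\to G$ a homomorphism of (small) groups. For a group $K$ let $\mathsf{B}K$ be the category with one object $\star$ and $\mathrm{End}(\star)=K$, identify $A$-linear representations of $K$ with functors $\mathsf{B}K\to A\text{-}\mathsf{Mod}$, and let $\mathcal{D}_A(\mathsf{B}K)=\mathbf{D}(A\text{-}\mathsf{Mod}^{\mathsf{B}K})$ be the unbounded derived category of the abelian category of such functors. Let $\mathsf{B}\phi\colon \mathsf{B}H\to\mathsf{B}G$ be the induced functor, let $\mathsf{B}\phi^*$ be precomposition with $\mathsf{B}\phi$ (an exact functor, so it induces a triangulated functor $\mathsf{B}\phi^*\colon \mathcal{D}_A(\mathsf{B}G)\to\mathcal{D}_A(\mathsf{B}H)$), and let $\mathsf{B}\phi_!$ and $\mathsf{B}\phi_*$ be the left and right Kan extension along $\mathsf{B}\phi$, extended degreewise to unbounded complexes. Let $\phi^\#$ be the restriction of representations along $\phi$, with its left adjoint $\mathrm{Ind}_H^G$ (induction, $M\mapsto (A[G]\otimes_A M)_H$) and its right adjoint $\mathrm{CoInd}_H^G$ (coinduction, the $H$-equivariant functions $G\to M$). (Derived Frobenius reciprocity.)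 The total left derived functor $\mathbf{L}\mathsf{B}\phi_!$ and the total right derived functor $\mathbf{R}\mathsf{B}\phi_*\colon\mathcal{D}_A(\mathsf{B}H)\to\mathcal{D}_A(\mathsf{B}G)$ exist, and there is a chain of adjunctions of triangulated functors \[ \mathbf{L}\mathsf{B}\phi_!\;\dashv\;\mathsf{B}\phi^*\;\dashv\;\mathbf{R}\mathsf{B}\phi_*, \] whose units and counits are induced by those of the underived adjunctions $\mathsf{B}\phi_!\dashv\mathsf{B}\phi^*\dashv\mathsf{B}\phi_*$. Moreover $\mathsf{B}\phi^*\cong\phi^\#$ canonically, and the induced identifications $\mathsf{B}\phi_!\cong\mathrm{Ind}_H^G$ and $\mathsf{B}\phi_*\cong\mathrm{CoInd}_H^G$ given by uniqueness of adjoints induce natural isomorphisms of derived functors $\mathbf{L}\mathsf{B}\phi_!\cong\mathbf{L}\mathrm{Ind}_H^G$ and $\mathbf{R}\mathsf{B}\phi_*\cong\mathbf{R}\mathrm{CoInd}_H^G$. In particular the corresponding chain of adjunctions $\mathbf{L}\mathrm{Ind}_H^G\dashv\phi^\#\dashv\mathbf{R}\mathrm{CoInd}_H^G$ holds as well. -/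

import Mathlib

open CategoryTheory Limits

universe u w₁ w₂



namespace DerivedFrobenius

/-! ## Adjunctions of complexes and derived adjunctions -/

section General

/-- The extension of an additive functor to unbounded cochain complexes. -/
noncomputable abbrev onComplexes {C D : Type*} [Category* C] [Category* D] [Preadditive C] [Preadditive D]
    (F : C ⥤ D) [F.Additive] : CochainComplex C ℤ ⥤ CochainComplex D ℤ :=
  F.mapHomologicalComplex (ComplexShape.up ℤ)

/-- An adjunction between additive functors, applied degreewise to complexes. -/
noncomputable def adjOnComplexes {C D : Type*} [Category* C] [Category* D] [Preadditive C] [Preadditive D]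
    {F : C ⥤ D} {G : D ⥤ C} [F.Additive] [G.Additive] (adj : F ⊣ G) :
    onComplexes F ⊣ onComplexes G where
  unit :=
    { app := fun K =>
        { f := fun i => adj.unit.app (K.X i)
          comm' := fun i j _ => (adj.unit.naturality (K.d i j)).symm }
      naturality := fun _ _ f => by
        ext i
        exact adj.unit.naturality (f.f i) }
  counit :=
    { app := fun K =>
        { f := fun i => adj.counit.app (K.X i)
          comm' := fun i j _ => (adj.counit.naturality (K.d i j)).symm }
      naturality := fun _ _ f => by
        ext i
        exact adj.counit.naturality (f.f i) }
  left_triangle_components := fun K => by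
    ext i
    exact adj.left_triangle_components (K.X i)
  right_triangle_components := fun K => by
    ext i
    exact adj.right_triangle_components (K.X i)

/-- A natural isomorphism between additive functors, applied degreewise to complexes. -/
noncomputable abbrev isoOnComplexes {C D : Type*} [Category* C] [Category* D] [Preadditive C] [Preadditive D]
    {F G : C ⥤ D} [F.Additive] [G.Additive] (e : F ≅ G) : onComplexes F ≅ onComplexes G :=
  NatIso.mapHomologicalComplex e (ComplexShape.up ℤ)

/-- Let `adj : F ⊣ G` be an adjunction and let `F'`, `G'` be functors on localizations
(via `L₁`, `L₂`) equipped with comparison maps `α : L₁ ⋙ F' ⟶ F ⋙ L₂` and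
`β : G ⋙ L₁ ⟶ L₂ ⋙ G'`. An adjunction `adj' : F' ⊣ G'` is *derived* from `adj` if its unit and
counit are induced by those of `adj` through the comparison maps. -/
def IsDerivedAdjunction {C₁ C₂ D₁ D₂ : Type*} [Category* C₁] [Category* C₂] [Category* D₁]
    [Category* D₂] {F : C₁ ⥤ C₂} {G : C₂ ⥤ C₁} (adj : F ⊣ G) {L₁ : C₁ ⥤ D₁} {L₂ : C₂ ⥤ D₂}
    {F' : D₁ ⥤ D₂} {G' : D₂ ⥤ D₁} (α : L₁ ⋙ F' ⟶ F ⋙ L₂) (β : G ⋙ L₁ ⟶ L₂ ⋙ G')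
    (adj' : F' ⊣ G') : Prop :=
  (∀ X : C₁, adj'.unit.app (L₁.obj X) ≫ G'.map (α.app X) =
    L₁.map (adj.unit.app X) ≫ β.app (F.obj X)) ∧
  (∀ Y : C₂, F'.map (β.app Y) ≫ adj'.counit.app (L₂.obj Y) =
    α.app (G.obj Y) ≫ L₂.map (adj.counit.app Y))

/-- Quasi-isomorphisms of unbounded cochain complexes. -/
abbrev qis (C : Type*) [Category* C] [Abelian C] : MorphismProperty (CochainComplex C ℤ) :=
  HomologicalComplex.quasiIso C (ComplexShape.up ℤ)

variable {C D : Type*} [Category* C] [Category* D] [Abelian C] [Abelian D]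
  [HasDerivedCategory.{w₁} C] [HasDerivedCategory.{w₂} D]

/-- Let `adj : F ⊣ G` be an adjunction between abelian categories with `F` additive and `G` exact.
This says that the total left derived functor `(L, α)` of `F` on unbounded derived categories
exists and, for every choice of it (they are all canonically isomorphic), `L` is a triangulated
functor compatibly with `α`, and there is an adjunction of triangulated functors between `L` and
the functor induced by `G`, which is derived from `adj`. -/
def HasLeftDerivedAdjunction {F : C ⥤ D} {G : D ⥤ C} [F.Additive] [G.Additive]
    [PreservesFiniteLimits G] [PreservesFiniteColimits G] (adj : F ⊣ G) : Prop :=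
  (onComplexes F ⋙ DerivedCategory.Q).HasLeftDerivedFunctor (qis C) ∧
  ∀ (L : DerivedCategory C ⥤ DerivedCategory D)
    (α : DerivedCategory.Q ⋙ L ⟶ onComplexes F ⋙ DerivedCategory.Q),
    L.IsLeftDerivedFunctor α (qis C) →
    ∃ (_ : L.CommShift ℤ) (adj' : L ⊣ G.mapDerivedCategory),
      L.IsTriangulated ∧ NatTrans.CommShift α ℤ ∧ adj'.CommShift ℤ ∧
      IsDerivedAdjunction (adjOnComplexes adj) α G.mapDerivedCategoryFactors.inv adj'

/-- Let `adj : G ⊣ F` be an adjunction between abelian categories with `F` additive and `G` exact.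
This says that the total right derived functor `(R, β)` of `F` on unbounded derived categories
exists and, for every choice of it (they are all canonically isomorphic), `R` is a triangulated
functor compatibly with `β`, and there is an adjunction of triangulated functors between the
functor induced by `G` and `R`, which is derived from `adj`. -/
def HasRightDerivedAdjunction {G : D ⥤ C} {F : C ⥤ D} [F.Additive] [G.Additive]
    [PreservesFiniteLimits G] [PreservesFiniteColimits G] (adj : G ⊣ F) : Prop :=
  (onComplexes F ⋙ DerivedCategory.Q).HasRightDerivedFunctor (qis C) ∧
  ∀ (R : DerivedCategory C ⥤ DerivedCategory D)
    (β : onComplexes F ⋙ DerivedCategory.Q ⟶ DerivedCategory.Q ⋙ R),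
    R.IsRightDerivedFunctor β (qis C) →
    ∃ (_ : R.CommShift ℤ) (adj' : G.mapDerivedCategory ⊣ R),
      R.IsTriangulated ∧ NatTrans.CommShift β ℤ ∧ adj'.CommShift ℤ ∧
      IsDerivedAdjunction (adjOnComplexes adj) G.mapDerivedCategoryFactors.hom β adj'

end General

/-! ## Representations as functors on the classifying category -/

section Representations

variable (A : Type u) [CommRing A]

/-- `A-Mod^{BG}`: functors from the one-object category `BG` to `A`-modules. -/
abbrev RepCat (G : Type u) [Group G] : Type (u + 1) := SingleObj G ⥤ ModuleCat.{u} A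

/-- The equivalence sending a representation `M` to the functor `BG ⥤ A-Mod` it defines. -/
noncomputable def repEquiv (G : Type u) [Group G] : Rep.{u} A G ≌ RepCat A G :=
  (Rep.repIsoAction A G).trans (Action.functorCategoryEquivalence (ModuleCat.{u} A) G)

variable {H G : Type u} [Group H] [Group G] (φ : H →* G)

/-- The functor `Bφ : BH ⥤ BG` induced by a group homomorphism. -/
abbrev B {H G : Type u} [Group H] [Group G] (φ : H →* G) : SingleObj H ⥤ SingleObj G :=
  SingleObj.mapHom H G φ

/-- `Bφ^*`: precomposition with `Bφ`. -/
abbrev Bpull : RepCat A G ⥤ RepCat A H :=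
  (Functor.whiskeringLeft _ _ (ModuleCat.{u} A)).obj (B φ)

/-- `Bφ_!`: left Kan extension along `Bφ`. -/
noncomputable abbrev Bshriek : RepCat A H ⥤ RepCat A G := (B φ).lan

/-- `Bφ_*`: right Kan extension along `Bφ`. -/
noncomputable abbrev Bstar : RepCat A H ⥤ RepCat A G := (B φ).ran

/-- `Bφ_! ⊣ Bφ^*`. -/
noncomputable abbrev BshriekAdj : Bshriek A φ ⊣ Bpull A φ := (B φ).lanAdjunction (ModuleCat.{u} A)

/-- `Bφ^* ⊣ Bφ_*`. -/
noncomputable abbrev BstarAdj : Bpull A φ ⊣ Bstar A φ := (B φ).ranAdjunction (ModuleCat.{u} A)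

/-- `φ^#`: restriction of representations along `φ`. -/
noncomputable def Res : RepCat A G ⥤ RepCat A H :=
  (repEquiv A G).inverse ⋙ Rep.resFunctor φ ⋙ (repEquiv A H).functor

/-- `Ind_H^G`: the induced representation `(A[G] ⊗ M)_H`. -/
noncomputable def Ind : RepCat A H ⥤ RepCat A G :=
  (repEquiv A H).inverse ⋙ Rep.indFunctor A φ ⋙ (repEquiv A G).functor

/-- `CoInd_H^G`: the coinduced representation, of `H`-equivariant functions `G → M`. -/
noncomputable def CoInd : RepCat A H ⥤ RepCat A G :=
  (repEquiv A H).inverse ⋙ Rep.coindFunctor A φ ⋙ (repEquiv A G).functor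

/-- Classical Frobenius reciprocity `Ind_H^G ⊣ φ^#`. -/
noncomputable def indAdj : Ind A φ ⊣ Res A φ :=
  ((repEquiv A H).symm.toAdjunction.comp
    ((Rep.indResAdjunction A φ).comp (repEquiv A G).toAdjunction))

/-- Classical Frobenius reciprocity `φ^# ⊣ CoInd_H^G`. -/
noncomputable def coindAdj : Res A φ ⊣ CoInd A φ :=
  ((repEquiv A G).symm.toAdjunction.comp
    ((Rep.resCoindAdjunction A φ).comp (repEquiv A H).toAdjunction))

/-- The identification of `Bφ^*` with `φ^#`; it is the identity on underlying modules. -/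
noncomputable def resIso : Bpull A φ ≅ Res A φ :=
  NatIso.ofComponents (fun F => NatIso.ofComponents (fun _ => Iso.refl _) )

instance : (Bpull A φ).Additive where

instance : (Res A φ).Additive := Functor.additive_of_iso (resIso A φ)

instance : (Bshriek A φ).Additive := (BshriekAdj A φ).left_adjoint_additive

instance : (Bstar A φ).Additive := (BstarAdj A φ).right_adjoint_additive

instance : (Ind A φ).Additive := (indAdj A φ).left_adjoint_additive

instance : (CoInd A φ).Additive := (coindAdj A φ).right_adjoint_additive

instance : PreservesFiniteLimits (Res A φ) := preservesFiniteLimits_of_natIso (resIso A φ)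

instance : PreservesFiniteColimits (Res A φ) := preservesFiniteColimits_of_natIso (resIso A φ)

end Representations

end DerivedFrobenius

/-! An adjunction of additive functors acts degreewise on complexes. It descends to unbounded
derived categories once the functor that is not exact can be computed on K-projective or K-injective
resolutions; restriction is exact and needs no resolution. The weight therefore lies on the
existence of these resolutions. `RepCat A G` is equivalent to modules over the group algebra, so it
has enough projectives and injectives; its countable products and coproducts are exact.

For a K-injective resolution of `K`, map `K` to a product of shifted injectives, injectively on
homology. The fibre `K₁ ⟶ K` is zero on homology, and in the homotopy category an acyclic complex
has the same morphisms to `K₁` as to `K` (`exists_ghost_to`). Iteration gives a tower over `K` with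
homotopy limit `X`. Since products are exact, `1 - s` (with `s` the shift of the tower) is the
identity on homology, so `X` is acyclic; by `bijective_comp_proj_of_tower`, acyclic complexes have
the same morphisms to `X` as to `K`. Hence the cone `I` of `X ⟶ K` is right orthogonal to acyclics,
that is K-injective, and `K ⟶ I` is a quasi-isomorphism. The K-projective case is dual.

Derived functors are then pointwise Kan extensions with the expected values on resolutions. So
composites of a derived functor with the exact functor are again derived functors, and unit and
counit descend. Shift structures are transported through the adjunction, and the comparison
isomorphisms come from uniqueness of adjoints and of derived functors. -/

namespace DerivedFrobenius

/-! ### Homotopy limits of towers and orthogonality in a pretriangulated category. -/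

section Towers

open Pretriangulated

variable {T : Type*} [Category* T] [HasZeroObject T] [HasShift T ℤ] [Preadditive T]
  [∀ n : ℤ, (shiftFunctor T n).Additive] [Pretriangulated T]
  (P : ObjectProperty T) [P.IsStableUnderShift ℤ]

/-- If `X ⟶ K` induces bijections on morphisms from objects in `P`, then its cone is right
orthogonal to `P`. -/
theorem rightOrthogonal_of_bijective {X K I : T} (g : X ⟶ K) (j : K ⟶ I) (k : I ⟶ X⟦(1 : ℤ)⟧)
    (hT : Triangle.mk g j k ∈ distTriang T)
    (hg : ∀ Z, P Z → Function.Bijective (fun m : Z ⟶ X => m ≫ g)) :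
    P.rightOrthogonal I := by
  intro Z f hZ
  -- Desuspended to a map `Z⟦-1⟧ ⟶ X`, this composite is killed by `g`, so injectivity applies.
  have hfk : f ≫ k = 0 := by
    let e : (Z⟦(-1 : ℤ)⟧)⟦(1 : ℤ)⟧ ≅ Z := (shiftEquiv T (1 : ℤ)).counitIso.app Z
    obtain ⟨m, hm⟩ := (shiftFunctor T (1 : ℤ)).map_surjective (e.hom ≫ f ≫ k)
    have h0 : m ≫ g = 0 := by
      apply (shiftFunctor T (1 : ℤ)).map_injective
      have : k ≫ g⟦(1 : ℤ)⟧' = 0 := comp_distTriang_mor_zero₃₁ _ hT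
      rw [Functor.map_comp, hm, Category.assoc, Category.assoc, this, comp_zero, comp_zero,
        Functor.map_zero]
    have h1 : m = 0 := (hg _ (P.le_shift (-1) _ hZ)).1 (by simpa using h0)
    rw [h1, Functor.map_zero] at hm
    rw [← cancel_epi e.hom, ← hm, comp_zero]
  obtain ⟨(l : Z ⟶ K), (hl : f = l ≫ j)⟩ := Triangle.coyoneda_exact₃ _ hT f hfk
  obtain ⟨m, hm⟩ := (hg _ hZ).2 l
  have : g ≫ j = 0 := comp_distTriang_mor_zero₁₂ _ hT
  dsimp at hm
  rw [hl, ← hm, Category.assoc, this, comp_zero]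

/-- If `K ⟶ X` induces bijections on morphisms to objects in `P`, then its shifted cone is left
orthogonal to `P`. -/
theorem leftOrthogonal_of_bijective {Q K X : T} (j : Q ⟶ K) (g : K ⟶ X) (k : X ⟶ Q⟦(1 : ℤ)⟧)
    (hT : Triangle.mk j g k ∈ distTriang T)
    (hg : ∀ Z, P Z → Function.Bijective (fun m : X ⟶ Z => g ≫ m)) :
    P.leftOrthogonal Q := by
  intro Z f hZ
  have hfk : k ≫ f⟦(1 : ℤ)⟧' = 0 := by
    apply (hg _ (P.le_shift 1 _ hZ)).1
    have : g ≫ k = 0 := comp_distTriang_mor_zero₂₃ _ hT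
    dsimp
    rw [reassoc_of% this, zero_comp, comp_zero]
  -- The sign comes from rotating the triangle twice.
  obtain ⟨(l : K⟦(1 : ℤ)⟧ ⟶ Z⟦(1 : ℤ)⟧), (hl : f⟦(1 : ℤ)⟧' = (-j⟦(1 : ℤ)⟧') ≫ l)⟩ :=
    Triangle.yoneda_exact₂ _ (rot_of_distTriang _ (rot_of_distTriang _ hT)) (f⟦(1 : ℤ)⟧') hfk
  obtain ⟨l', rfl⟩ := (shiftFunctor T (1 : ℤ)).map_surjective l
  have h1 : f = -(j ≫ l') := by
    apply (shiftFunctor T (1 : ℤ)).map_injective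
    rw [hl, Functor.map_neg, Functor.map_comp, Preadditive.neg_comp]
  obtain ⟨m, hm⟩ := (hg _ hZ).2 l'
  have : j ≫ g = 0 := comp_distTriang_mor_zero₁₂ _ hT
  dsimp at hm
  rw [h1, ← hm, reassoc_of% this, zero_comp, neg_zero]

/-- The homotopy limit of a tower whose transition maps are bijective on morphisms from objects
in `P` has the same morphisms from objects in `P` as the bottom of the tower. -/
theorem bijective_comp_proj_of_tower {K : ℕ → T} (f : ∀ n, K (n + 1) ⟶ K n)
    (hf : ∀ Z, P Z → ∀ n, Function.Bijective (fun m : Z ⟶ K (n + 1) => m ≫ f n))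
    {c : Fan K} (hc : IsLimit c) (s : c.pt ⟶ c.pt)
    (hs : ∀ n, s ≫ c.proj n = c.proj (n + 1) ≫ f n)
    {X : T} (i : X ⟶ c.pt) (δ : c.pt ⟶ X⟦(1 : ℤ)⟧)
    (hT : Triangle.mk i (𝟙 _ - s) δ ∈ distTriang T) (Z : T) (hZ : P Z) :
    Function.Bijective (fun m : Z ⟶ X => m ≫ i ≫ c.proj 0) := by
  have h12 : i ≫ (𝟙 _ - s) = 0 := comp_distTriang_mor_zero₁₂ _ hT
  have h23 : (𝟙 _ - s) ≫ δ = 0 := comp_distTriang_mor_zero₂₃ _ hT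
  have his : i ≫ s = i := by
    rw [Preadditive.comp_sub, Category.comp_id, sub_eq_zero] at h12
    exact h12.symm
  refine ⟨?_, fun g => ?_⟩
  · suffices ∀ h : Z ⟶ X, h ≫ i ≫ c.proj 0 = 0 → h = 0 by
      intro a b hab
      rw [← sub_eq_zero]
      apply this
      rw [Preadditive.sub_comp, sub_eq_zero]
      exact hab
    intro h hh
    have hn : ∀ n, h ≫ i ≫ c.proj n = 0 := by
      intro n
      induction n with
      | zero => exact hh
      | succ n ih =>
        apply (hf Z hZ n).1
        dsimp
        rw [zero_comp, ← ih, Category.assoc, Category.assoc, ← hs, reassoc_of% his]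
    have hi : h ≫ i = 0 := by
      refine Fan.IsLimit.hom_ext hc _ _ fun n => ?_
      rw [Category.assoc, hn, zero_comp]
    have hi' : h⟦(1 : ℤ)⟧' ≫ i⟦(1 : ℤ)⟧' = 0 := by
      rw [← Functor.map_comp, hi, Functor.map_zero]
    obtain ⟨(g : Z⟦(1 : ℤ)⟧ ⟶ c.pt), (hg : h⟦(1 : ℤ)⟧' = g ≫ δ)⟩ :=
      Triangle.coyoneda_exact₁ _ hT (h⟦(1 : ℤ)⟧') hi'
    -- Vanishing of lim¹: `v ≫ (1 - s) = g` is solved recursively up the tower by surjectivity of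
    -- the transition maps; the starting value 0 is arbitrary.
    let F (n : ℕ) : Type _ := Z⟦(1 : ℤ)⟧ ⟶ K n
    choose b hb using fun (n : ℕ) (x : F n) => (hf _ (P.le_shift 1 _ hZ) n).2 x
    let v : ∀ n, F n := fun n => Nat.rec (motive := F) 0 (fun n x => b n (x - g ≫ c.proj n)) n
    have hv : ∀ n, v (n + 1) ≫ f n = v n - g ≫ c.proj n := fun n => hb n _
    have hg' : Fan.IsLimit.lift hc v ≫ (𝟙 _ - s) = g := by
      refine Fan.IsLimit.hom_ext hc _ _ fun n => ?_
      rw [Category.assoc, Preadditive.sub_comp, Category.id_comp, hs, Preadditive.comp_sub,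
        Fan.IsLimit.fac, Fan.IsLimit.fac_assoc, hv]
      abel
    apply (shiftFunctor T (1 : ℤ)).map_injective
    rw [hg, ← hg', Category.assoc, h23, comp_zero, Functor.map_zero]
  -- Lifting `g` step by step up the tower gives a compatible family, which `1 - s` kills; it
  -- therefore factors through `i`.
  · let F (n : ℕ) : Type _ := Z ⟶ K n
    choose b hb using fun (n : ℕ) (x : F n) => (hf _ hZ n).2 x
    let v : ∀ n, F n := fun n => Nat.rec (motive := F) g (fun n x => b n x) n
    have hv : ∀ n, v (n + 1) ≫ f n = v n := fun n => hb n _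
    have hv' : Fan.IsLimit.lift hc v ≫ (𝟙 _ - s) = 0 := by
      refine Fan.IsLimit.hom_ext hc _ _ fun n => ?_
      rw [Category.assoc, Preadditive.sub_comp, Category.id_comp, hs, Preadditive.comp_sub,
        Fan.IsLimit.fac, Fan.IsLimit.fac_assoc, hv, sub_self, zero_comp]
    obtain ⟨(m : Z ⟶ X), (hm : Fan.IsLimit.lift hc v = m ≫ i)⟩ :=
      Triangle.coyoneda_exact₂ _ hT (Fan.IsLimit.lift hc v) hv'
    refine ⟨m, ?_⟩
    dsimp
    rw [← reassoc_of% hm, Fan.IsLimit.fac]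
    rfl

/-- The homotopy colimit of a sequence whose transition maps are bijective on morphisms to objects
in `P` has the same morphisms to objects in `P` as the start of the sequence. -/
theorem bijective_inj_comp_of_sequence {K : ℕ → T} (f : ∀ n, K n ⟶ K (n + 1))
    (hf : ∀ Z, P Z → ∀ n, Function.Bijective (fun m : K (n + 1) ⟶ Z => f n ≫ m))
    {c : Cofan K} (hc : IsColimit c) (s : c.pt ⟶ c.pt)
    (hs : ∀ n, c.inj n ≫ s = f n ≫ c.inj (n + 1))
    {X : T} (p : c.pt ⟶ X) (δ : X ⟶ c.pt⟦(1 : ℤ)⟧)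
    (hT : Triangle.mk (𝟙 _ - s) p δ ∈ distTriang T) (Z : T) (hZ : P Z) :
    Function.Bijective (fun m : X ⟶ Z => (c.inj 0 ≫ p) ≫ m) := by
  have h12 : (𝟙 _ - s) ≫ p = 0 := comp_distTriang_mor_zero₁₂ _ hT
  have h31 : δ ≫ (𝟙 _ - s)⟦(1 : ℤ)⟧' = 0 := comp_distTriang_mor_zero₃₁ _ hT
  have hsp : s ≫ p = p := by
    rw [Preadditive.sub_comp, Category.id_comp, sub_eq_zero] at h12
    exact h12.symm
  refine ⟨?_, fun g => ?_⟩
  · suffices ∀ h : X ⟶ Z, (c.inj 0 ≫ p) ≫ h = 0 → h = 0 by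
      intro a b hab
      rw [← sub_eq_zero]
      apply this
      rw [Preadditive.comp_sub, sub_eq_zero]
      exact hab
    intro h hh
    have hn : ∀ n, c.inj n ≫ p ≫ h = 0 := by
      intro n
      induction n with
      | zero => rw [← Category.assoc]; exact hh
      | succ n ih =>
        apply (hf Z hZ n).1
        dsimp
        rw [comp_zero, ← ih, ← reassoc_of% hs, reassoc_of% hsp]
    have hp : p ≫ h = 0 := by
      refine Cofan.IsColimit.hom_ext hc _ _ fun n => ?_
      rw [hn, comp_zero]
    obtain ⟨(w : c.pt⟦(1 : ℤ)⟧ ⟶ Z), (hw : h = δ ≫ w)⟩ := Triangle.yoneda_exact₃ _ hT h hp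
    -- The factor `w` starts at a shifted coproduct; it is desuspended so that the recursion can be
    -- run with target `Z⟦-1⟧`.
    let e : (Z⟦(-1 : ℤ)⟧)⟦(1 : ℤ)⟧ ≅ Z := (shiftEquiv T (1 : ℤ)).counitIso.app Z
    obtain ⟨g, hg⟩ := (shiftFunctor T (1 : ℤ)).map_surjective (w ≫ e.inv)
    let F (n : ℕ) : Type _ := K n ⟶ Z⟦(-1 : ℤ)⟧
    choose b hb using fun (n : ℕ) (x : F n) => (hf _ (P.le_shift (-1) _ hZ) n).2 x
    let v : ∀ n, F n := fun n => Nat.rec (motive := F) 0 (fun n x => b n (x - c.inj n ≫ g)) n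
    have hv : ∀ n, f n ≫ v (n + 1) = v n - c.inj n ≫ g := fun n => hb n _
    have hg' : (𝟙 _ - s) ≫ Cofan.IsColimit.desc hc v = g := by
      refine Cofan.IsColimit.hom_ext hc _ _ fun n => ?_
      rw [← Category.assoc, Preadditive.comp_sub, Category.comp_id, hs, Preadditive.sub_comp,
        Category.assoc, Cofan.IsColimit.fac, Cofan.IsColimit.fac, hv]
      abel
    rw [hw, ← cancel_mono e.inv, Category.assoc, ← hg, ← hg', Functor.map_comp,
      reassoc_of% h31, zero_comp, zero_comp]
  · let F (n : ℕ) : Type _ := K n ⟶ Z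
    choose b hb using fun (n : ℕ) (x : F n) => (hf _ hZ n).2 x
    let v : ∀ n, F n := fun n => Nat.rec (motive := F) g (fun n x => b n x) n
    have hv : ∀ n, f n ≫ v (n + 1) = v n := fun n => hb n _
    have hv' : (𝟙 _ - s) ≫ Cofan.IsColimit.desc hc v = 0 := by
      refine Cofan.IsColimit.hom_ext hc _ _ fun n => ?_
      rw [← Category.assoc, Preadditive.comp_sub, Category.comp_id, hs, Preadditive.sub_comp,
        Category.assoc, Cofan.IsColimit.fac, Cofan.IsColimit.fac, hv, sub_self, comp_zero]
    obtain ⟨(m : X ⟶ Z), (hm : Cofan.IsColimit.desc hc v = p ≫ m)⟩ :=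
      Triangle.yoneda_exact₂ _ hT (Cofan.IsColimit.desc hc v) hv'
    refine ⟨m, ?_⟩
    dsimp
    rw [Category.assoc, ← hm, Cofan.IsColimit.fac]
    rfl

end Towers

/-! ### Degreewise products and coproducts of complexes. -/

section Products

variable {C : Type*} [Category* C] [Abelian C] {J : Type*}

/-- A family of complexes, as a complex of families of objects. -/
@[simps]
def familyComplex (K : J → CochainComplex C ℤ) : CochainComplex (Discrete J ⥤ C) ℤ where
  X i := Discrete.functor fun m => (K m).X i
  d i j := Discrete.natTrans fun m => (K m.as).d i j
  shape i j h := by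
    ext m
    exact (K m.as).shape i j h
  d_comp_d' i j k _ _ := by
    ext m
    exact (K m.as).d_comp_d i j k

section Product

variable [HasLimitsOfShape (Discrete J) C]

/-- The degreewise product of a family of complexes. -/
noncomputable def prodComplex (K : J → CochainComplex C ℤ) : CochainComplex C ℤ :=
  ((lim : (Discrete J ⥤ C) ⥤ C).mapHomologicalComplex _).obj (familyComplex K)

/-- The projections of the degreewise product. -/
noncomputable def prodComplexπ (K : J → CochainComplex C ℤ) (m : J) : prodComplex K ⟶ K m where
  f i := limit.π ((familyComplex K).X i) ⟨m⟩
  comm' i j _ := (limMap_π ((familyComplex K).d i j) ⟨m⟩).symm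

theorem prodComplex_hom_ext {K : J → CochainComplex C ℤ} {A : C} {i : ℤ}
    {f g : A ⟶ (prodComplex K).X i}
    (h : ∀ m, f ≫ (prodComplexπ K m).f i = g ≫ (prodComplexπ K m).f i) : f = g :=
  limit.hom_ext fun m => h m.as

theorem exists_prodComplex_lift {K : J → CochainComplex C ℤ} {A : C} {i : ℤ}
    (f : ∀ m, A ⟶ (K m).X i) :
    ∃ l : A ⟶ (prodComplex K).X i, ∀ m, l ≫ (prodComplexπ K m).f i = f m :=
  ⟨limit.lift ((familyComplex K).X i) ⟨A, Discrete.natTrans fun m => f m.as⟩,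
    fun m => limit.lift_π _ (⟨m⟩ : Discrete J)⟩

theorem exists_lift_prodComplex {K : J → CochainComplex C ℤ} {Z : CochainComplex C ℤ}
    (f : ∀ m, Z ⟶ K m) : ∃ l : Z ⟶ prodComplex K, ∀ m, l ≫ prodComplexπ K m = f m := by
  choose l hl using fun i => exists_prodComplex_lift (fun m => (f m).f i)
  refine ⟨{ f := l, comm' := fun i j _ => prodComplex_hom_ext fun m => ?_ }, fun m => ?_⟩
  · rw [Category.assoc, Category.assoc, ← (prodComplexπ K m).comm, hl, ← Category.assoc, hl,
      (f m).comm]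
  · ext i
    exact hl i m

/-- Homotopies chosen separately on the factors assemble componentwise. This gives uniqueness for
products in the homotopy category and stability of K-injectivity under products. -/
theorem nonempty_homotopy_zero_prodComplex {K : J → CochainComplex C ℤ} {Z : CochainComplex C ℤ}
    (f : Z ⟶ prodComplex K) (h : ∀ m, Homotopy (f ≫ prodComplexπ K m) 0) :
    Nonempty (Homotopy f 0) := by
  choose l hl using fun i j => exists_prodComplex_lift (fun m => (h m).hom i j)
  refine ⟨{ hom := l, zero := fun i j hij => ?_, comm := fun i => ?_ }⟩
  · refine prodComplex_hom_ext fun m => ?_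
    rw [hl, (h m).zero i j hij, zero_comp]
  · refine prodComplex_hom_ext fun m => ?_
    have := (h m).comm i
    simp only [dNext_eq _ (show (ComplexShape.up ℤ).Rel i (i + 1) from rfl),
      prevD_eq _ (show (ComplexShape.up ℤ).Rel (i - 1) i by simp), HomologicalComplex.zero_f,
      HomologicalComplex.comp_f, add_zero] at this ⊢
    rw [this, Preadditive.add_comp, Category.assoc, Category.assoc, hl,
      ← (prodComplexπ K m).comm, reassoc_of% hl]

/-- The degreewise product is a product in the homotopy category. -/
theorem nonempty_isLimit_prodComplex (K : J → CochainComplex C ℤ) :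
    Nonempty (IsLimit (Fan.mk ((HomotopyCategory.quotient C (.up ℤ)).obj (prodComplex K))
      fun m => (HomotopyCategory.quotient C (.up ℤ)).map (prodComplexπ K m))) := by
  let q := HomotopyCategory.quotient C (.up ℤ)
  have hex (Y : HomotopyCategory C (.up ℤ)) (f : ∀ m, Y ⟶ q.obj (K m)) :
      ∃ l : Y ⟶ q.obj (prodComplex K), ∀ m, l ≫ q.map (prodComplexπ K m) = f m := by
    obtain ⟨Z, rfl⟩ := HomotopyCategory.quotient_obj_surjective Y
    choose g hg using fun m => q.map_surjective (f m)
    obtain ⟨l, hl⟩ := exists_lift_prodComplex g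
    exact ⟨q.map l, fun m => by rw [← q.map_comp, hl, hg]⟩
  have huniq (Y : HomotopyCategory C (.up ℤ)) (f : Y ⟶ q.obj (prodComplex K))
      (hf : ∀ m, f ≫ q.map (prodComplexπ K m) = 0) : f = 0 := by
    obtain ⟨Z, rfl⟩ := HomotopyCategory.quotient_obj_surjective Y
    obtain ⟨f, rfl⟩ := q.map_surjective f
    obtain ⟨h⟩ := nonempty_homotopy_zero_prodComplex f fun m =>
      HomotopyCategory.homotopyOfEq _ _ (by rw [Functor.map_zero, Functor.map_comp]; exact hf m)
    rw [HomotopyCategory.eq_of_homotopy _ _ h, Functor.map_zero]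
  choose l hl using hex
  refine ⟨Fan.IsLimit.mk _ (fun s => l s.pt s.proj) (fun s m => hl _ _ m) fun s m hm => ?_⟩
  rw [← sub_eq_zero]
  apply huniq
  intro j
  rw [Preadditive.sub_comp, hl, sub_eq_zero]
  exact hm j

instance isKInjective_prodComplex (K : J → CochainComplex C ℤ) [∀ m, (K m).IsKInjective] :
    (prodComplex K).IsKInjective where
  nonempty_homotopy_zero f hK :=
    nonempty_homotopy_zero_prodComplex f fun _ =>
      CochainComplex.IsKInjective.homotopyZero _ hK

/-- If products are exact, the homology of a product of complexes embeds into the product of the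
homologies. -/
theorem homology_prodComplex_hom_ext [HasExactLimitsOfShape (Discrete J) C]
    (K : J → CochainComplex C ℤ) {A : C} {n : ℤ} {x y : A ⟶ (prodComplex K).homology n}
    (h : ∀ m, x ≫ HomologicalComplex.homologyMap (prodComplexπ K m) n =
      y ≫ HomologicalComplex.homologyMap (prodComplexπ K m) n) : x = y := by
  let S := (familyComplex K).sc n
  let τ (m : J) : (lim : (Discrete J ⥤ C) ⥤ C) ⟶ (evaluation _ _).obj ⟨m⟩ :=
    { app := fun F => limit.π F ⟨m⟩ }
  -- `lim` and evaluation are both exact, so they commute with homology; naturality of `τ m` then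
  -- identifies the projections on the two sides.
  let e : (prodComplex K).homology n ≅ limit S.homology := S.mapHomologyIso lim
  let e' (m : J) : (K m).homology n ≅ S.homology.obj ⟨m⟩ :=
    S.mapHomologyIso ((evaluation _ _).obj ⟨m⟩)
  have key (m : J) : limit.π S.homology ⟨m⟩ =
      e.inv ≫ HomologicalComplex.homologyMap (prodComplexπ K m) n ≫ (e' m).hom :=
    NatTrans.app_homology (τ m) S
  rw [← cancel_mono e.hom]
  refine limit.hom_ext fun m => ?_
  rw [key m.as, Category.assoc, Category.assoc, e.hom_inv_id_assoc,
    ← Category.assoc, h m.as, Category.assoc]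

end Product

section Coproduct

variable [HasColimitsOfShape (Discrete J) C]

/-- The degreewise coproduct of a family of complexes. -/
noncomputable def coprodComplex (K : J → CochainComplex C ℤ) : CochainComplex C ℤ :=
  ((colim : (Discrete J ⥤ C) ⥤ C).mapHomologicalComplex _).obj (familyComplex K)

/-- The inclusions in the degreewise coproduct. -/
noncomputable def coprodComplexι (K : J → CochainComplex C ℤ) (m : J) : K m ⟶ coprodComplex K where
  f i := colimit.ι ((familyComplex K).X i) ⟨m⟩
  comm' i j _ := ι_colimMap ((familyComplex K).d i j) ⟨m⟩

theorem coprodComplex_hom_ext {K : J → CochainComplex C ℤ} {A : C} {i : ℤ}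
    {f g : (coprodComplex K).X i ⟶ A}
    (h : ∀ m, (coprodComplexι K m).f i ≫ f = (coprodComplexι K m).f i ≫ g) : f = g :=
  colimit.hom_ext fun m => h m.as

theorem exists_coprodComplex_desc {K : J → CochainComplex C ℤ} {A : C} {i : ℤ}
    (f : ∀ m, (K m).X i ⟶ A) :
    ∃ l : (coprodComplex K).X i ⟶ A, ∀ m, (coprodComplexι K m).f i ≫ l = f m :=
  ⟨colimit.desc ((familyComplex K).X i) ⟨A, Discrete.natTrans fun m => f m.as⟩,
    fun m => colimit.ι_desc _ (⟨m⟩ : Discrete J)⟩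

theorem exists_desc_coprodComplex {K : J → CochainComplex C ℤ} {Z : CochainComplex C ℤ}
    (f : ∀ m, K m ⟶ Z) : ∃ l : coprodComplex K ⟶ Z, ∀ m, coprodComplexι K m ≫ l = f m := by
  choose l hl using fun i => exists_coprodComplex_desc (fun m => (f m).f i)
  refine ⟨{ f := l, comm' := fun i j _ => coprodComplex_hom_ext fun m => ?_ }, fun m => ?_⟩
  · rw [← Category.assoc, hl, ← Category.assoc, (coprodComplexι K m).comm, Category.assoc, hl,
      (f m).comm]
  · ext i
    exact hl i m

theorem nonempty_homotopy_zero_coprodComplex {K : J → CochainComplex C ℤ}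
    {Z : CochainComplex C ℤ} (f : coprodComplex K ⟶ Z)
    (h : ∀ m, Homotopy (coprodComplexι K m ≫ f) 0) : Nonempty (Homotopy f 0) := by
  choose l hl using fun i j => exists_coprodComplex_desc (fun m => (h m).hom i j)
  refine ⟨{ hom := l, zero := fun i j hij => ?_, comm := fun i => ?_ }⟩
  · refine coprodComplex_hom_ext fun m => ?_
    rw [hl, (h m).zero i j hij, comp_zero]
  · refine coprodComplex_hom_ext fun m => ?_
    have := (h m).comm i
    simp only [dNext_eq _ (show (ComplexShape.up ℤ).Rel i (i + 1) from rfl),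
      prevD_eq _ (show (ComplexShape.up ℤ).Rel (i - 1) i by simp), HomologicalComplex.zero_f,
      HomologicalComplex.comp_f, add_zero] at this ⊢
    rw [this, Preadditive.comp_add, (coprodComplexι K m).comm_assoc, hl, reassoc_of% hl]

/-- The degreewise coproduct is a coproduct in the homotopy category. -/
theorem nonempty_isColimit_coprodComplex (K : J → CochainComplex C ℤ) :
    Nonempty (IsColimit (Cofan.mk ((HomotopyCategory.quotient C (.up ℤ)).obj (coprodComplex K))
      fun m => (HomotopyCategory.quotient C (.up ℤ)).map (coprodComplexι K m))) := by
  let q := HomotopyCategory.quotient C (.up ℤ)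
  have hex (Y : HomotopyCategory C (.up ℤ)) (f : ∀ m, q.obj (K m) ⟶ Y) :
      ∃ l : q.obj (coprodComplex K) ⟶ Y, ∀ m, q.map (coprodComplexι K m) ≫ l = f m := by
    obtain ⟨Z, rfl⟩ := HomotopyCategory.quotient_obj_surjective Y
    choose g hg using fun m => q.map_surjective (f m)
    obtain ⟨l, hl⟩ := exists_desc_coprodComplex g
    exact ⟨q.map l, fun m => by rw [← q.map_comp, hl, hg]⟩
  have huniq (Y : HomotopyCategory C (.up ℤ)) (f : q.obj (coprodComplex K) ⟶ Y)
      (hf : ∀ m, q.map (coprodComplexι K m) ≫ f = 0) : f = 0 := by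
    obtain ⟨Z, rfl⟩ := HomotopyCategory.quotient_obj_surjective Y
    obtain ⟨f, rfl⟩ := q.map_surjective f
    obtain ⟨h⟩ := nonempty_homotopy_zero_coprodComplex f fun m =>
      HomotopyCategory.homotopyOfEq _ _ (by rw [Functor.map_zero, Functor.map_comp]; exact hf m)
    rw [HomotopyCategory.eq_of_homotopy _ _ h, Functor.map_zero]
  choose l hl using hex
  refine ⟨Cofan.IsColimit.mk _ (fun s => l s.pt s.inj) (fun s m => hl _ _ m) fun s m hm => ?_⟩
  rw [← sub_eq_zero]
  apply huniq
  intro j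
  rw [Preadditive.comp_sub, hl, sub_eq_zero]
  exact hm j

instance isKProjective_coprodComplex (K : J → CochainComplex C ℤ) [∀ m, (K m).IsKProjective] :
    (coprodComplex K).IsKProjective where
  nonempty_homotopy_zero f hK :=
    nonempty_homotopy_zero_coprodComplex f fun _ =>
      CochainComplex.IsKProjective.homotopyZero _ hK

/-- If coproducts are exact, the homology of a coproduct of complexes is covered by the coproduct
of the homologies. -/
theorem homology_coprodComplex_hom_ext [HasExactColimitsOfShape (Discrete J) C]
    (K : J → CochainComplex C ℤ) {A : C} {n : ℤ} {x y : (coprodComplex K).homology n ⟶ A}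
    (h : ∀ m, HomologicalComplex.homologyMap (coprodComplexι K m) n ≫ x =
      HomologicalComplex.homologyMap (coprodComplexι K m) n ≫ y) : x = y := by
  let S := (familyComplex K).sc n
  let τ (m : J) : (evaluation _ _).obj ⟨m⟩ ⟶ (colim : (Discrete J ⥤ C) ⥤ C) :=
    { app := fun F => colimit.ι F ⟨m⟩ }
  let e : (coprodComplex K).homology n ≅ colimit S.homology := S.mapHomologyIso colim
  let e' (m : J) : (K m).homology n ≅ S.homology.obj ⟨m⟩ :=
    S.mapHomologyIso ((evaluation _ _).obj ⟨m⟩)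
  have key (m : J) : colimit.ι S.homology ⟨m⟩ =
      (e' m).inv ≫ HomologicalComplex.homologyMap (coprodComplexι K m) n ≫ e.hom :=
    NatTrans.app_homology (τ m) S
  rw [← cancel_epi e.inv]
  refine colimit.hom_ext fun m => ?_
  rw [key m.as, Category.assoc, Category.assoc, Category.assoc, Category.assoc,
    e.hom_inv_id_assoc, e.hom_inv_id_assoc, h m.as]

end Coproduct

end Products

/-! ### K-injective and K-projective resolutions of unbounded complexes. -/

section Resolutions

open Pretriangulated HomologicalComplex

variable {C : Type*} [Category* C] [Abelian C]

/-- A bounded below complex of injectives is K-injective. -/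
instance isKInjective_single (E : C) [Injective E] (n : ℤ) :
    CochainComplex.IsKInjective ((single C (ComplexShape.up ℤ) n).obj E) := by
  have : ∀ i, Injective (((single C (ComplexShape.up ℤ) n).obj E).X i) := fun i => by
    by_cases hi : i = n
    · exact Injective.of_iso (singleObjXIsoOfEq (ComplexShape.up ℤ) n E i hi).symm inferInstance
    · exact (isZero_single_obj_X (ComplexShape.up ℤ) n E i hi).injective
  exact CochainComplex.isKInjective_of_injective _ n

instance isKProjective_single (E : C) [Projective E] (n : ℤ) :
    CochainComplex.IsKProjective ((single C (ComplexShape.up ℤ) n).obj E) := by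
  have : ∀ i, Projective (((single C (ComplexShape.up ℤ) n).obj E).X i) := fun i => by
    by_cases hi : i = n
    · exact Projective.of_iso (singleObjXIsoOfEq (ComplexShape.up ℤ) n E i hi).symm inferInstance
    · exact (isZero_single_obj_X (ComplexShape.up ℤ) n E i hi).projective
  exact CochainComplex.isKProjective_of_projective _ n

/-- Homology is a subobject of the opcycles, so an embedding of it into an injective extends to the
opcycles, and a map out of the opcycles is a chain map to a single complex. -/
theorem exists_single_mono_homologyMap [EnoughInjectives C] (K : CochainComplex C ℤ) (n : ℤ) :
    ∃ (E : C) (_ : Injective E) (f : K ⟶ (single C (ComplexShape.up ℤ) n).obj E),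
      Mono (homologyMap f n) := by
  let φ : K.opcycles n ⟶ Injective.under (K.homology n) :=
    Injective.factorThru (Injective.ι _) (K.homologyι n)
  have hφ : K.homologyι n ≫ φ = Injective.ι _ := Injective.comp_factorThru _ _
  let f : K ⟶ (single C (ComplexShape.up ℤ) n).obj (Injective.under (K.homology n)) :=
    mkHomToSingle (K.pOpcycles n ≫ φ) (fun i _ => by rw [d_pOpcycles_assoc, zero_comp])
  refine ⟨_, inferInstance, f, ?_⟩
  have hf : opcyclesMap f n = φ ≫ (singleObjOpcyclesSelfIso (ComplexShape.up ℤ) n _).hom := by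
    rw [← cancel_epi (K.pOpcycles n), p_opcyclesMap, mkHomToSingle_f, singleObjOpcyclesSelfIso_hom,
      Category.assoc, Category.assoc]
  have : Mono (homologyMap f n ≫ homologyι _ n) := by
    rw [homologyι_naturality, hf, reassoc_of% hφ]
    infer_instance
  exact mono_of_mono _ (homologyι _ n)

/-- Dually, a projective covering the homology lifts to the cycles. -/
theorem exists_single_epi_homologyMap [EnoughProjectives C] (K : CochainComplex C ℤ) (n : ℤ) :
    ∃ (E : C) (_ : Projective E) (f : (single C (ComplexShape.up ℤ) n).obj E ⟶ K),
      Epi (homologyMap f n) := by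
  let φ : Projective.over (K.homology n) ⟶ K.cycles n :=
    Projective.factorThru (Projective.π _) (K.homologyπ n)
  have hφ : φ ≫ K.homologyπ n = Projective.π _ := Projective.factorThru_comp _ _
  let f : (single C (ComplexShape.up ℤ) n).obj (Projective.over (K.homology n)) ⟶ K :=
    mkHomFromSingle (φ ≫ K.iCycles n) (fun i _ => by rw [Category.assoc, iCycles_d, comp_zero])
  refine ⟨_, inferInstance, f, ?_⟩
  have hf : cyclesMap f n = (singleObjCyclesSelfIso (ComplexShape.up ℤ) n _).hom ≫ φ := by
    rw [← cancel_mono (K.iCycles n), cyclesMap_i, mkHomFromSingle_f, singleObjCyclesSelfIso_hom,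
      Category.assoc, Category.assoc]
  have : Epi (homologyπ _ n ≫ homologyMap f n) := by
    rw [homologyπ_naturality, hf, Category.assoc, hφ]
    infer_instance
  exact epi_of_epi (homologyπ _ n) _

/-- Take the product of one single complex per degree: in degree `n` the composite with the `n`-th
projection is already mono on homology. -/
theorem exists_isKInjective_mono_homologyMap [EnoughInjectives C]
    [HasLimitsOfShape (Discrete ℤ) C] (K : CochainComplex C ℤ) :
    ∃ (I : CochainComplex C ℤ) (_ : I.IsKInjective) (f : K ⟶ I), ∀ n, Mono (homologyMap f n) := by
  choose E hE g hg using exists_single_mono_homologyMap K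
  obtain ⟨l, hl⟩ := exists_lift_prodComplex g
  refine ⟨_, inferInstance, l, fun n => ?_⟩
  have : Mono (homologyMap l n ≫ homologyMap (prodComplexπ _ n) n) := by
    rw [← homologyMap_comp, hl]
    exact hg n
  exact mono_of_mono _ (homologyMap (prodComplexπ _ n) n)

theorem exists_isKProjective_epi_homologyMap [EnoughProjectives C]
    [HasColimitsOfShape (Discrete ℤ) C] (K : CochainComplex C ℤ) :
    ∃ (I : CochainComplex C ℤ) (_ : I.IsKProjective) (f : I ⟶ K), ∀ n, Epi (homologyMap f n) := by
  choose E hE g hg using exists_single_epi_homologyMap K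
  obtain ⟨l, hl⟩ := exists_desc_coprodComplex g
  refine ⟨_, inferInstance, l, fun n => ?_⟩
  have : Epi (homologyMap (coprodComplexι _ n) n ≫ homologyMap l n) := by
    rw [← homologyMap_comp, hl]
    exact hg n
  exact epi_of_epi (homologyMap (coprodComplexι _ n) n) _

/-- Take the fibre of a map `i` from `K` to a K-injective, mono on homology. As `f ≫ i` is
null-homotopic, `f` is zero on homology; the bijection holds because acyclics have no nonzero
morphisms to the K-injective. -/
theorem exists_ghost_to [EnoughInjectives C] [HasLimitsOfShape (Discrete ℤ) C]
    (K : CochainComplex C ℤ) : ∃ (K' : CochainComplex C ℤ) (f : K' ⟶ K),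
      (∀ n, homologyMap f n = 0) ∧ ∀ Z, HomotopyCategory.subcategoryAcyclic C Z →
        Function.Bijective (fun m : Z ⟶ (HomotopyCategory.quotient C (.up ℤ)).obj K' =>
          m ≫ (HomotopyCategory.quotient C (.up ℤ)).map f) := by
  let q := HomotopyCategory.quotient C (.up ℤ)
  let P := HomotopyCategory.subcategoryAcyclic C
  obtain ⟨I, _, i, hi⟩ := exists_isKInjective_mono_homologyMap K
  have hI : P.rightOrthogonal (q.obj I) := CochainComplex.IsKInjective.rightOrthogonal I
  obtain ⟨K', f, δ, hT⟩ := distinguished_cocone_triangle₁ (q.map i)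
  obtain ⟨K', rfl⟩ := HomotopyCategory.quotient_obj_surjective K'
  obtain ⟨f, rfl⟩ := q.map_surjective f
  refine ⟨K', f, fun n => ?_, fun Z hZ => ⟨?_, fun g => ?_⟩⟩
  · have h : q.map (f ≫ i) = q.map 0 := by
      rw [q.map_comp, q.map_zero]
      exact comp_distTriang_mor_zero₁₂ _ hT
    rw [← cancel_mono (homologyMap i n), ← homologyMap_comp, zero_comp,
      (HomotopyCategory.homotopyOfEq _ _ h).homologyMap_eq, homologyMap_zero]
  · suffices ∀ h : Z ⟶ q.obj K', h ≫ q.map f = 0 → h = 0 by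
      intro a b hab
      rw [← sub_eq_zero]
      apply this
      rw [Preadditive.sub_comp, sub_eq_zero]
      exact hab
    intro h hh
    have h' : h⟦(1 : ℤ)⟧' ≫ (q.map f)⟦(1 : ℤ)⟧' = 0 := by
      rw [← Functor.map_comp, hh, Functor.map_zero]
    obtain ⟨(g : Z⟦(1 : ℤ)⟧ ⟶ q.obj I), (hg : h⟦(1 : ℤ)⟧' = g ≫ δ)⟩ :=
      Triangle.coyoneda_exact₁ _ hT (h⟦(1 : ℤ)⟧') h'
    apply (shiftFunctor _ (1 : ℤ)).map_injective
    rw [hg, hI g (P.le_shift 1 _ hZ), zero_comp, Functor.map_zero]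
  · obtain ⟨m, hm⟩ := Triangle.coyoneda_exact₂ _ hT g (hI _ hZ)
    exact ⟨m, hm.symm⟩

theorem exists_ghost_from [EnoughProjectives C] [HasColimitsOfShape (Discrete ℤ) C]
    (K : CochainComplex C ℤ) : ∃ (K' : CochainComplex C ℤ) (f : K ⟶ K'),
      (∀ n, homologyMap f n = 0) ∧ ∀ Z, HomotopyCategory.subcategoryAcyclic C Z →
        Function.Bijective (fun m : (HomotopyCategory.quotient C (.up ℤ)).obj K' ⟶ Z =>
          (HomotopyCategory.quotient C (.up ℤ)).map f ≫ m) := by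
  let q := HomotopyCategory.quotient C (.up ℤ)
  let P := HomotopyCategory.subcategoryAcyclic C
  obtain ⟨I, _, i, hi⟩ := exists_isKProjective_epi_homologyMap K
  have hI : P.leftOrthogonal (q.obj I) := CochainComplex.IsKProjective.leftOrthogonal I
  obtain ⟨K', f, δ, hT⟩ := distinguished_cocone_triangle (q.map i)
  obtain ⟨K', rfl⟩ := HomotopyCategory.quotient_obj_surjective K'
  obtain ⟨f, rfl⟩ := q.map_surjective f
  refine ⟨K', f, fun n => ?_, fun Z hZ => ⟨?_, fun g => ?_⟩⟩
  · have h : q.map (i ≫ f) = q.map 0 := by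
      rw [q.map_comp, q.map_zero]
      exact comp_distTriang_mor_zero₁₂ _ hT
    rw [← cancel_epi (homologyMap i n), ← homologyMap_comp, comp_zero,
      (HomotopyCategory.homotopyOfEq _ _ h).homologyMap_eq, homologyMap_zero]
  · suffices ∀ h : q.obj K' ⟶ Z, q.map f ≫ h = 0 → h = 0 by
      intro a b hab
      rw [← sub_eq_zero]
      apply this
      rw [Preadditive.comp_sub, sub_eq_zero]
      exact hab
    intro h hh
    obtain ⟨(g : (q.obj I)⟦(1 : ℤ)⟧ ⟶ Z), (hg : h = δ ≫ g)⟩ := Triangle.yoneda_exact₃ _ hT h hh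
    rw [hg, P.leftOrthogonal.le_shift 1 _ hI g hZ, comp_zero]
  · obtain ⟨m, hm⟩ := Triangle.yoneda_exact₂ _ hT g (hI _ hZ)
    exact ⟨m, hm.symm⟩

theorem trW_one_sub_of_homologyMap_eq_zero {K : CochainComplex C ℤ} (s : K ⟶ K)
    (hs : ∀ n, homologyMap s n = 0) :
    (HomotopyCategory.subcategoryAcyclic C).trW
      (𝟙 ((HomotopyCategory.quotient C (.up ℤ)).obj K) -
        (HomotopyCategory.quotient C (.up ℤ)).map s) := by
  rw [← HomotopyCategory.quasiIso_eq_trW_subcategoryAcyclic, ← CategoryTheory.Functor.map_id, ← Functor.map_sub,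
    HomotopyCategory.quotient_map_mem_quasiIso_iff, mem_quasiIso_iff, quasiIso_iff]
  intro n
  rw [quasiIsoAt_iff_isIso_homologyMap, homologyMap_sub, hs, sub_zero, homologyMap_id]
  infer_instance

/-- Existence of K-injective resolutions of unbounded complexes. -/
theorem exists_kInjective_resolution [EnoughInjectives C] [HasLimitsOfShape (Discrete ℤ) C]
    [HasLimitsOfShape (Discrete ℕ) C] [HasExactLimitsOfShape (Discrete ℕ) C]
    (K : CochainComplex C ℤ) :
    ∃ (I : CochainComplex C ℤ) (_ : I.IsKInjective) (f : K ⟶ I), qis C f := by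
  let q := HomotopyCategory.quotient C (.up ℤ)
  let P := HomotopyCategory.subcategoryAcyclic C
  choose next φ hφ₀ hφ using exists_ghost_to (C := C)
  let F (n : ℕ) : CochainComplex C ℤ := Nat.rec K (fun _ L => next L) n
  let f (n : ℕ) : F (n + 1) ⟶ F n := φ (F n)
  obtain ⟨hc⟩ := nonempty_isLimit_prodComplex F
  obtain ⟨s, hs⟩ := exists_lift_prodComplex fun n => prodComplexπ F (n + 1) ≫ f n
  have hs₀ (n : ℤ) : homologyMap s n = 0 := by
    refine homology_prodComplex_hom_ext F fun m => ?_
    rw [← homologyMap_comp, hs, homologyMap_comp, hφ₀, comp_zero, zero_comp]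
  have hs' : P.trW (𝟙 (q.obj (prodComplex F)) - q.map s) :=
    trW_one_sub_of_homologyMap_eq_zero s hs₀
  -- `X` is the homotopy limit of the tower, acyclic as the fibre of a quasi-isomorphism.
  obtain ⟨X, i, δ, hT, hX⟩ := (P.trW_iff' _).1 hs'
  let p : X ⟶ q.obj K := i ≫ q.map (prodComplexπ F 0)
  obtain ⟨I, j, k, hT'⟩ := distinguished_cocone_triangle p
  obtain ⟨I, rfl⟩ := HomotopyCategory.quotient_obj_surjective I
  obtain ⟨j, rfl⟩ := q.map_surjective j
  have hI : P.rightOrthogonal (q.obj I) :=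
    rightOrthogonal_of_bijective P p (q.map j) k hT' fun Z hZ =>
      bijective_comp_proj_of_tower P (fun n => q.map (f n)) (fun Z hZ n => hφ (F n) Z hZ) hc
        (q.map s) (fun n => ((q.map_comp _ _).symm.trans (congrArg q.map (hs n))).trans (q.map_comp _ _)) i δ hT Z hZ
  refine ⟨I, (CochainComplex.isKInjective_iff_rightOrthogonal I).2 hI, j, ?_⟩
  refine (HomotopyCategory.quotient_map_mem_quasiIso_iff j).1 ?_
  rw [HomotopyCategory.quasiIso_eq_trW_subcategoryAcyclic]
  exact ObjectProperty.trW.mk' P hT' hX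

/-- Existence of K-projective resolutions of unbounded complexes. -/
theorem exists_kProjective_resolution [EnoughProjectives C] [HasColimitsOfShape (Discrete ℤ) C]
    [HasColimitsOfShape (Discrete ℕ) C] [HasExactColimitsOfShape (Discrete ℕ) C]
    (K : CochainComplex C ℤ) :
    ∃ (I : CochainComplex C ℤ) (_ : I.IsKProjective) (f : I ⟶ K), qis C f := by
  let q := HomotopyCategory.quotient C (.up ℤ)
  let P := HomotopyCategory.subcategoryAcyclic C
  choose next φ hφ₀ hφ using exists_ghost_from (C := C)
  let F (n : ℕ) : CochainComplex C ℤ := Nat.rec K (fun _ L => next L) n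
  let f (n : ℕ) : F n ⟶ F (n + 1) := φ (F n)
  obtain ⟨hc⟩ := nonempty_isColimit_coprodComplex F
  obtain ⟨s, hs⟩ := exists_desc_coprodComplex fun n => f n ≫ coprodComplexι F (n + 1)
  have hs₀ (n : ℤ) : homologyMap s n = 0 := by
    refine homology_coprodComplex_hom_ext F fun m => ?_
    rw [← homologyMap_comp, hs, homologyMap_comp, hφ₀, comp_zero, zero_comp]
  have hs' : P.trW (𝟙 (q.obj (coprodComplex F)) - q.map s) :=
    trW_one_sub_of_homologyMap_eq_zero s hs₀
  -- `X` is the homotopy colimit of the sequence, acyclic as the cone of a quasi-isomorphism.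
  obtain ⟨X, i, δ, hT, hX⟩ := (P.trW_iff _).1 hs'
  let p : q.obj K ⟶ X := q.map (coprodComplexι F 0) ≫ i
  obtain ⟨I, j, k, hT'⟩ := distinguished_cocone_triangle₁ p
  obtain ⟨I, rfl⟩ := HomotopyCategory.quotient_obj_surjective I
  obtain ⟨j, rfl⟩ := q.map_surjective j
  have hI : P.leftOrthogonal (q.obj I) :=
    leftOrthogonal_of_bijective P (q.map j) p k hT' fun Z hZ =>
      bijective_inj_comp_of_sequence P (fun n => q.map (f n)) (fun Z hZ n => hφ (F n) Z hZ) hc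
        (q.map s) (fun n => ((q.map_comp _ _).symm.trans (congrArg q.map (hs n))).trans (q.map_comp _ _)) i δ hT Z hZ
  refine ⟨I, (CochainComplex.isKProjective_iff_leftOrthogonal I).2 hI, j, ?_⟩
  refine (HomotopyCategory.quotient_map_mem_quasiIso_iff j).1 ?_
  rw [HomotopyCategory.quasiIso_eq_trW_subcategoryAcyclic]
  exact ObjectProperty.trW.mk P hT' hX

end Resolutions

/-! ### Derived functors computed on resolving classes of objects. -/

section DerivedFunctors

open Functor

variable {C D E : Type*} [Category* C] [Category* D] [Category* E]

/-- The objects satisfying `P` resolve all objects on the right, and morphisms to them in the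
localization `L` with respect to `W` lift along `L`. -/
structure RightResolving (L : C ⥤ D) (W : MorphismProperty C) (P : ObjectProperty C) : Prop where
  exists_resolution (X : C) : ∃ (Y : C) (w : X ⟶ Y), P Y ∧ W w
  map_surjective (X Y : C) (hY : P Y) (f : L.obj X ⟶ L.obj Y) : ∃ g, L.map g = f

/-- The objects satisfying `P` resolve all objects on the left, and morphisms from them in the
localization `L` with respect to `W` lift along `L`. -/
structure LeftResolving (L : C ⥤ D) (W : MorphismProperty C) (P : ObjectProperty C) : Prop where
  exists_resolution (X : C) : ∃ (Y : C) (w : Y ⟶ X), P Y ∧ W w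
  map_surjective (Y X : C) (hY : P Y) (f : L.obj Y ⟶ L.obj X) : ∃ g, L.map g = f

section Right

variable {L : C ⥤ D} {W : MorphismProperty C} {P : ObjectProperty C}
  (hP : RightResolving L W P) (F : C ⥤ E)

include hP

/-- The value of `F` on an object satisfying `P` computes its pointwise right derived functor. -/
theorem RightResolving.exists_isColimit
    (hF : ∀ X Y, P Y → ∀ f g : X ⟶ Y, L.map f = L.map g → F.map f = F.map g) (Y : C) (hY : P Y) :
    ∃ c : Cocone (CostructuredArrow.proj L (L.obj Y) ⋙ F), Nonempty (IsColimit c) ∧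
      IsIso (c.ι.app (CostructuredArrow.mk (𝟙 (L.obj Y)))) := by
  -- The lifts are neither unique nor functorial, but `hF` makes their images under `F` independent
  -- of choices. The arrow `𝟙` thus behaves as a terminal object after applying `F`.
  choose l hl using fun (j : CostructuredArrow L (L.obj Y)) =>
    hP.map_surjective j.left Y hY j.hom
  let c : Cocone (CostructuredArrow.proj L (L.obj Y) ⋙ F) :=
    { pt := F.obj Y
      ι :=
        { app := fun j => F.map (l j)
          naturality := fun j k f => by
            change F.map f.left ≫ F.map (l k) = F.map (l j) ≫ 𝟙 _
            rw [Category.comp_id, ← F.map_comp]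
            refine hF _ _ hY _ _ ?_
            rw [L.map_comp, hl, hl]
            exact CostructuredArrow.w f } }
  have hid : F.map (l (CostructuredArrow.mk (𝟙 (L.obj Y)))) = 𝟙 _ := by
    rw [← F.map_id]
    refine hF _ _ hY _ _ ?_
    rw [hl, L.map_id]
    rfl
  refine ⟨c, ⟨⟨fun s => s.ι.app (CostructuredArrow.mk (𝟙 (L.obj Y))), fun s j => ?_,
    fun s m hm => ?_⟩⟩, ?_⟩
  · let φ : j ⟶ CostructuredArrow.mk (𝟙 (L.obj Y)) :=
      CostructuredArrow.homMk (l j) ((Category.comp_id _).trans (hl j))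
    exact s.w φ
  · rw [← hm]
    change m = F.map (l (CostructuredArrow.mk (𝟙 (L.obj Y)))) ≫ m
    rw [hid]
    exact (Category.id_comp m).symm
  · change IsIso (F.map (l (CostructuredArrow.mk (𝟙 (L.obj Y)))))
    rw [hid]
    infer_instance

variable [L.IsLocalization W]

/-- Pointwise existence is invariant along `W`, so it may be checked on a resolution. -/
theorem RightResolving.hasPointwiseRightDerivedFunctor
    (hF : ∀ X Y, P Y → ∀ f g : X ⟶ Y, L.map f = L.map g → F.map f = F.map g) :
    F.HasPointwiseRightDerivedFunctor W := by
  intro X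
  obtain ⟨Y, w, hY, hw⟩ := hP.exists_resolution X
  rw [F.hasPointwiseRightDerivedFunctorAt_iff_of_mem W w hw,
    F.hasPointwiseRightDerivedFunctorAt_iff L W]
  obtain ⟨c, ⟨hc⟩, -⟩ := hP.exists_isColimit F hF Y hY
  exact ⟨c, hc⟩

theorem RightResolving.isIso_app
    (hF : ∀ X Y, P Y → ∀ f g : X ⟶ Y, L.map f = L.map g → F.map f = F.map g)
    {R : D ⥤ E} (β : F ⟶ L ⋙ R) [R.IsRightDerivedFunctor β W] (Y : C) (hY : P Y) :
    IsIso (β.app Y) := by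
  have := hP.hasPointwiseRightDerivedFunctor F hF
  obtain ⟨c, ⟨hc⟩, hi⟩ := hP.exists_isColimit F hF Y hY
  let hR := isPointwiseLeftKanExtensionOfHasPointwiseRightDerivedFunctor R β W (L.obj Y)
  have h := hc.comp_coconePointUniqueUpToIso_hom hR (CostructuredArrow.mk (𝟙 (L.obj Y)))
  have h' : β.app Y = ((LeftExtension.mk R β).coconeAt (L.obj Y)).ι.app
      (CostructuredArrow.mk (𝟙 (L.obj Y))) := by
    change β.app Y = β.app Y ≫ R.map (𝟙 (L.obj Y))
    rw [R.map_id]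
    exact (Category.comp_id _).symm
  rw [h', ← h]
  exact IsIso.comp_isIso' hi (Iso.isIso_hom _)

/-- Every object of `D` is isomorphic to some `L.obj Y` with `P Y`, so the universal property is
needed only there, where the inverse of `β.app Y` supplies the descent maps. This recognises
composites as derived functors. -/
theorem RightResolving.isRightDerivedFunctor {F : C ⥤ E} {R : D ⥤ E} (β : F ⟶ L ⋙ R)
    (hβ : ∀ Y, P Y → IsIso (β.app Y)) : R.IsRightDerivedFunctor β W where
  isLeftKanExtension := by
    have := Localization.essSurj L W
    refine LeftExtension.IsPointwiseLeftKanExtension.isLeftKanExtension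
      (E := LeftExtension.mk R β) fun Z => Nonempty.some ?_
    obtain ⟨Y, w, hY, hw⟩ := hP.exists_resolution (L.objPreimage Z)
    let b : F.obj Y ⟶ R.obj (L.obj Y) := β.app Y
    obtain ⟨i, hi₁, hi₂⟩ : ∃ i, b ≫ i = 𝟙 _ ∧ i ≫ b = 𝟙 _ := (hβ Y hY).out
    let s₀ (s : Cocone (CostructuredArrow.proj L (L.obj Y) ⋙ F)) : F.obj Y ⟶ s.pt :=
      s.ι.app (CostructuredArrow.mk (𝟙 (L.obj Y)))
    refine ⟨(LeftExtension.mk R β).isPointwiseLeftKanExtensionAtOfIso' (Y := L.obj Y)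
      { desc := fun s => i ≫ s₀ s
        fac := fun s j => ?_
        uniq := fun s m hm => ?_ }
      ((Localization.isoOfHom L W w hw).symm ≪≫ L.objObjPreimageIso Z)⟩
    · obtain ⟨l, hl⟩ := hP.map_surjective j.left Y hY j.hom
      let bj : F.obj j.left ⟶ R.obj (L.obj j.left) := β.app j.left
      let sj : F.obj j.left ⟶ s.pt := s.ι.app j
      let φ : j ⟶ CostructuredArrow.mk (𝟙 (L.obj Y)) :=
        CostructuredArrow.homMk l ((Category.comp_id _).trans hl)
      have h1 : F.map l ≫ s₀ s = sj := s.w φ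
      have h2 : F.map l ≫ b = bj ≫ R.map (L.map l) := β.naturality l
      have h3 : (bj ≫ R.map (L.map l)) ≫ i ≫ s₀ s = sj := by
        rw [← h2, Category.assoc, reassoc_of% hi₁, h1]
      exact (congrArg (fun f => (bj ≫ R.map f) ≫ i ≫ s₀ s) hl.symm).trans h3
    · let m' : R.obj (L.obj Y) ⟶ s.pt := m
      have h1 : (b ≫ R.map (𝟙 (L.obj Y))) ≫ m' = s₀ s :=
        hm (CostructuredArrow.mk (𝟙 (L.obj Y)))
      have h2 : m' = i ≫ s₀ s := by
        rw [← h1, R.map_id, Category.comp_id, reassoc_of% hi₂]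
      exact h2

end Right

section Left

variable {L : C ⥤ D} {W : MorphismProperty C} {P : ObjectProperty C}
  (hP : LeftResolving L W P) (F : C ⥤ E)

include hP

/-- The value of `F` on an object satisfying `P` computes its pointwise left derived functor. -/
theorem LeftResolving.exists_isLimit
    (hF : ∀ Y X, P Y → ∀ f g : Y ⟶ X, L.map f = L.map g → F.map f = F.map g) (Y : C) (hY : P Y) :
    ∃ c : Cone (StructuredArrow.proj (L.obj Y) L ⋙ F), Nonempty (IsLimit c) ∧
      IsIso (c.π.app (StructuredArrow.mk (𝟙 (L.obj Y)))) := by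
  choose l hl using fun (j : StructuredArrow (L.obj Y) L) =>
    hP.map_surjective Y j.right hY j.hom
  let c : Cone (StructuredArrow.proj (L.obj Y) L ⋙ F) :=
    { pt := F.obj Y
      π :=
        { app := fun j => F.map (l j)
          naturality := fun j k f => by
            change 𝟙 _ ≫ F.map (l k) = F.map (l j) ≫ F.map f.right
            rw [Category.id_comp, ← F.map_comp]
            refine hF _ _ hY _ _ ?_
            rw [L.map_comp, hl, hl]
            exact (StructuredArrow.w f).symm } }
  have hid : F.map (l (StructuredArrow.mk (𝟙 (L.obj Y)))) = 𝟙 _ := by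
    rw [← F.map_id]
    refine hF _ _ hY _ _ ?_
    rw [hl, L.map_id]
    rfl
  refine ⟨c, ⟨⟨fun s => s.π.app (StructuredArrow.mk (𝟙 (L.obj Y))), fun s j => ?_,
    fun s m hm => ?_⟩⟩, ?_⟩
  · let φ : StructuredArrow.mk (𝟙 (L.obj Y)) ⟶ j :=
      StructuredArrow.homMk (l j) ((Category.id_comp _).trans (hl j))
    exact s.w φ
  · rw [← hm]
    change m = m ≫ F.map (l (StructuredArrow.mk (𝟙 (L.obj Y))))
    rw [hid]
    exact (Category.comp_id m).symm
  · change IsIso (F.map (l (StructuredArrow.mk (𝟙 (L.obj Y)))))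
    rw [hid]
    infer_instance

variable [L.IsLocalization W]

theorem LeftResolving.hasPointwiseLeftDerivedFunctor
    (hF : ∀ Y X, P Y → ∀ f g : Y ⟶ X, L.map f = L.map g → F.map f = F.map g) :
    F.HasPointwiseLeftDerivedFunctor W := by
  intro X
  obtain ⟨Y, w, hY, hw⟩ := hP.exists_resolution X
  rw [← F.hasPointwiseLeftDerivedFunctorAt_iff_of_mem W w hw,
    F.hasPointwiseLeftDerivedFunctorAt_iff L W]
  obtain ⟨c, ⟨hc⟩, -⟩ := hP.exists_isLimit F hF Y hY
  exact ⟨c, hc⟩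

theorem LeftResolving.isIso_app
    (hF : ∀ Y X, P Y → ∀ f g : Y ⟶ X, L.map f = L.map g → F.map f = F.map g)
    {R : D ⥤ E} (α : L ⋙ R ⟶ F) [R.IsLeftDerivedFunctor α W] (Y : C) (hY : P Y) :
    IsIso (α.app Y) := by
  have := hP.hasPointwiseLeftDerivedFunctor F hF
  obtain ⟨c, ⟨hc⟩, hi⟩ := hP.exists_isLimit F hF Y hY
  let hR := isPointwiseRightKanExtensionOfHasPointwiseLeftDerivedFunctor R α W (L.obj Y)
  have h := hR.conePointUniqueUpToIso_hom_comp hc (StructuredArrow.mk (𝟙 (L.obj Y)))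
  have h' : α.app Y = ((RightExtension.mk R α).coneAt (L.obj Y)).π.app
      (StructuredArrow.mk (𝟙 (L.obj Y))) := by
    change α.app Y = R.map (𝟙 (L.obj Y)) ≫ α.app Y
    rw [R.map_id]
    exact (Category.id_comp _).symm
  rw [h', ← h]
  exact IsIso.comp_isIso' (Iso.isIso_hom _) hi

theorem LeftResolving.isLeftDerivedFunctor {F : C ⥤ E} {R : D ⥤ E} (α : L ⋙ R ⟶ F)
    (hα : ∀ Y, P Y → IsIso (α.app Y)) : R.IsLeftDerivedFunctor α W where
  isRightKanExtension := by
    have := Localization.essSurj L W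
    refine RightExtension.IsPointwiseRightKanExtension.isRightKanExtension
      (E := RightExtension.mk R α) fun Z => Nonempty.some ?_
    obtain ⟨Y, w, hY, hw⟩ := hP.exists_resolution (L.objPreimage Z)
    let b : R.obj (L.obj Y) ⟶ F.obj Y := α.app Y
    obtain ⟨i, hi₁, hi₂⟩ : ∃ i, b ≫ i = 𝟙 _ ∧ i ≫ b = 𝟙 _ := (hα Y hY).out
    let s₀ (s : Cone (StructuredArrow.proj (L.obj Y) L ⋙ F)) : s.pt ⟶ F.obj Y :=
      s.π.app (StructuredArrow.mk (𝟙 (L.obj Y)))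
    refine ⟨(RightExtension.mk R α).isPointwiseRightKanExtensionAtOfIso' (Y := L.obj Y)
      { lift := fun s => s₀ s ≫ i
        fac := fun s j => ?_
        uniq := fun s m hm => ?_ }
      (Localization.isoOfHom L W w hw ≪≫ L.objObjPreimageIso Z)⟩
    · obtain ⟨l, hl⟩ := hP.map_surjective Y j.right hY j.hom
      let bj : R.obj (L.obj j.right) ⟶ F.obj j.right := α.app j.right
      let sj : s.pt ⟶ F.obj j.right := s.π.app j
      let φ : StructuredArrow.mk (𝟙 (L.obj Y)) ⟶ j :=
        StructuredArrow.homMk l ((Category.id_comp _).trans hl)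
      have h1 : s₀ s ≫ F.map l = sj := s.w φ
      have h2 : R.map (L.map l) ≫ bj = b ≫ F.map l := α.naturality l
      have h3 : (s₀ s ≫ i) ≫ R.map (L.map l) ≫ bj = sj := by
        rw [h2, Category.assoc, reassoc_of% hi₂, h1]
      exact (congrArg (fun f => (s₀ s ≫ i) ≫ R.map f ≫ bj) hl.symm).trans h3
    · let m' : s.pt ⟶ R.obj (L.obj Y) := m
      have h1 : m' ≫ R.map (𝟙 (L.obj Y)) ≫ b = s₀ s := hm (StructuredArrow.mk (𝟙 (L.obj Y)))
      have h2 : m' = s₀ s ≫ i := by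
        rw [← h1, R.map_id, Category.id_comp, Category.assoc, hi₁, Category.comp_id]
      exact h2

end Left

end DerivedFunctors

/-! ### K-injectives and K-projectives as resolving classes. -/

section KResolutions

variable {C : Type*} [Category* C] [Abelian C] [HasDerivedCategory.{w₁} C]

open DerivedCategory

theorem Q_map_surjective_of_isKInjective (K L : CochainComplex C ℤ) [L.IsKInjective]
    (f : Q.obj K ⟶ Q.obj L) : ∃ g : K ⟶ L, Q.map g = f := by
  obtain ⟨g, hg⟩ := (CochainComplex.IsKInjective.Qh_map_bijective
    ((HomotopyCategory.quotient _ _).obj K) L).2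
    ((quotientCompQhIso C).hom.app K ≫ f ≫ (quotientCompQhIso C).inv.app L)
  obtain ⟨g, rfl⟩ := (HomotopyCategory.quotient _ _).map_surjective g
  refine ⟨g, ?_⟩
  rw [← cancel_mono ((quotientCompQhIso C).inv.app L), quotientCompQhIso_inv_naturality, hg,
    Iso.inv_hom_id_app_assoc]

theorem Q_map_surjective_of_isKProjective (K L : CochainComplex C ℤ) [K.IsKProjective]
    (f : Q.obj K ⟶ Q.obj L) : ∃ g : K ⟶ L, Q.map g = f := by
  obtain ⟨g, hg⟩ := (CochainComplex.IsKProjective.Qh_map_bijective K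
    ((HomotopyCategory.quotient _ _).obj L)).2
    ((quotientCompQhIso C).hom.app K ≫ f ≫ (quotientCompQhIso C).inv.app L)
  obtain ⟨g, rfl⟩ := (HomotopyCategory.quotient _ _).map_surjective g
  refine ⟨g, ?_⟩
  rw [← cancel_mono ((quotientCompQhIso C).inv.app L), quotientCompQhIso_inv_naturality, hg,
    Iso.inv_hom_id_app_assoc]

theorem nonempty_homotopy_of_isKInjective (K L : CochainComplex C ℤ) [L.IsKInjective]
    {f g : K ⟶ L} (h : Q.map f = Q.map g) : Nonempty (Homotopy f g) := by
  refine ⟨HomotopyCategory.homotopyOfEq _ _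
    ((CochainComplex.IsKInjective.Qh_map_bijective _ L).1 ?_)⟩
  rw [← cancel_mono ((quotientCompQhIso C).hom.app L), quotientCompQhIso_hom_naturality,
    quotientCompQhIso_hom_naturality, h]

theorem nonempty_homotopy_of_isKProjective (K L : CochainComplex C ℤ) [K.IsKProjective]
    {f g : K ⟶ L} (h : Q.map f = Q.map g) : Nonempty (Homotopy f g) := by
  refine ⟨HomotopyCategory.homotopyOfEq _ _
    ((CochainComplex.IsKProjective.Qh_map_bijective K _).1 ?_)⟩
  rw [← cancel_mono ((quotientCompQhIso C).hom.app L), quotientCompQhIso_hom_naturality,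
    quotientCompQhIso_hom_naturality, h]

theorem rightResolving_isKInjective [EnoughInjectives C] [HasLimitsOfShape (Discrete ℤ) C]
    [HasLimitsOfShape (Discrete ℕ) C] [HasExactLimitsOfShape (Discrete ℕ) C] :
    RightResolving (Q (C := C)) (qis C) CochainComplex.IsKInjective where
  exists_resolution K := by
    obtain ⟨I, hI, f, hf⟩ := exists_kInjective_resolution K
    exact ⟨I, f, hI, hf⟩
  map_surjective K L hL f := Q_map_surjective_of_isKInjective K L f

theorem leftResolving_isKProjective [EnoughProjectives C] [HasColimitsOfShape (Discrete ℤ) C]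
    [HasColimitsOfShape (Discrete ℕ) C] [HasExactColimitsOfShape (Discrete ℕ) C] :
    LeftResolving (Q (C := C)) (qis C) CochainComplex.IsKProjective where
  exists_resolution K := by
    obtain ⟨I, hI, f, hf⟩ := exists_kProjective_resolution K
    exact ⟨I, f, hI, hf⟩
  map_surjective K L hL f := Q_map_surjective_of_isKProjective K L f

variable {D : Type*} [Category* D] [Abelian D] [HasDerivedCategory.{w₂} D]

/-- Maps into a K-injective that agree in the derived category are homotopic, and additive functors
preserve homotopies. -/
theorem onComplexes_Q_map_eq_of_isKInjective (F : C ⥤ D) [F.Additive] (K L : CochainComplex C ℤ)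
    (hL : L.IsKInjective) (f g : K ⟶ L) (h : Q.map f = Q.map g) :
    (onComplexes F ⋙ Q).map f = (onComplexes F ⋙ Q).map g := by
  obtain ⟨h⟩ := nonempty_homotopy_of_isKInjective K L h
  exact DerivedCategory.Q_map_eq_of_homotopy _ (F.mapHomotopy h)

theorem onComplexes_Q_map_eq_of_isKProjective (F : C ⥤ D) [F.Additive] (K L : CochainComplex C ℤ)
    (hK : K.IsKProjective) (f g : K ⟶ L) (h : Q.map f = Q.map g) :
    (onComplexes F ⋙ Q).map f = (onComplexes F ⋙ Q).map g := by
  obtain ⟨h⟩ := nonempty_homotopy_of_isKProjective K L h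
  exact DerivedCategory.Q_map_eq_of_homotopy _ (F.mapHomotopy h)

end KResolutions

/-! ### Derived adjunctions and their compatibility with shifts. -/

section DerivedAdjunctions

open Functor DerivedCategory

section CommShift

variable {C D : Type*} [Category* C] [Category* D] [Preadditive C] [Preadditive D]
  {F : C ⥤ D} {G : D ⥤ C} [F.Additive] [G.Additive] (adj : F ⊣ G)

instance adjOnComplexes_commShift : (adjOnComplexes adj).CommShift ℤ := by
  -- Compatibility of the unit with shifts forces that of the counit.
  refine Adjunction.CommShift.mk' _ _ ⟨fun a => ?_⟩
  ext K i
  simp only [Functor.commShiftIso_comp_hom_app, Functor.commShiftIso_id_hom_app, NatTrans.comp_app,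
    whiskerRight_app, whiskerLeft_app, HomologicalComplex.comp_f,
    Functor.mapHomologicalComplex_map_f, mapHomologicalComplex_commShiftIso_hom_app_f]
  erw [G.map_id, Category.comp_id, Category.comp_id]
  exact Category.id_comp (adj.unit.app (K.X (i + a)))

end CommShift

variable {C D : Type*} [Category* C] [Category* D] [Abelian C] [Abelian D]
  [HasDerivedCategory.{w₁} C] [HasDerivedCategory.{w₂} D]

theorem hasLeftDerivedAdjunction [EnoughProjectives C] [HasColimitsOfShape (Discrete ℤ) C]
    [HasColimitsOfShape (Discrete ℕ) C] [HasExactColimitsOfShape (Discrete ℕ) C]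
    {F : C ⥤ D} {G : D ⥤ C} [F.Additive] [G.Additive]
    [PreservesFiniteLimits G] [PreservesFiniteColimits G] (adj : F ⊣ G) :
    HasLeftDerivedAdjunction adj := by
  have hP := leftResolving_isKProjective (C := C)
  have hF := onComplexes_Q_map_eq_of_isKProjective F
  have := hP.hasPointwiseLeftDerivedFunctor _ hF
  refine ⟨inferInstance, fun L α hα => ?_⟩
  have hα' := hP.isIso_app _ hF α
  let G' := G.mapDerivedCategory
  let β : onComplexes G ⋙ Q ⟶ Q ⋙ G' := G.mapDerivedCategoryFactors.inv
  -- The exact functor `G` preserves quasi-isomorphisms, so no resolution is needed on this side.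
  have : G'.IsRightDerivedFunctor β (qis D) :=
    isRightDerivedFunctor_of_inverts (qis D) G' G.mapDerivedCategoryFactors
  -- On K-projectives `α` is invertible, hence so is its image under `G'`.
  have : (L ⋙ G').IsLeftDerivedFunctor
      ((Functor.associator _ _ _).inv ≫ whiskerRight α G') (qis C) :=
    hP.isLeftDerivedFunctor _ fun Y hY => by
      have := hα' Y hY
      simp only [NatTrans.comp_app, associator_inv_app, whiskerRight_app]
      infer_instance
  have : (G' ⋙ L).IsRightDerivedFunctor
      (whiskerRight β L ≫ (Functor.associator _ _ _).hom) (qis D) :=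
    isRightDerivedFunctor_of_inverts (qis D) (G' ⋙ L)
      ((Functor.associator _ _ _).symm ≪≫ isoWhiskerRight G.mapDerivedCategoryFactors L)
  let adj' : L ⊣ G' := (adjOnComplexes adj).derived (qis C) (qis D) α β
  have hadj : IsDerivedAdjunction (adjOnComplexes adj) α β adj' :=
    ⟨fun X => (adjOnComplexes adj).derivedη_fac_app (qis C) α β X,
      fun Y => (adjOnComplexes adj).derivedε_fac_app (qis D) α β Y⟩
  -- `L` carries no shift structure a priori; it receives the one making `adj'` compatible with that
  -- of `G'`.
  let := adj'.leftAdjointCommShift ℤ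
  have hs := adj'.commShift_of_rightAdjoint ℤ
  have ht := adj'.isTriangulated_leftAdjoint
  refine ⟨inferInstance, adj', ht, ?_, hs, hadj⟩
  -- `α` is the mate of `β`: it is written through the unit of `adj`, `β` and the counit of `adj'`,
  -- each of which commutes with shifts.
  have h : α = whiskerRight (Q.leftUnitor.inv ≫ whiskerRight (adjOnComplexes adj).unit Q ≫
      (Functor.associator _ _ _).hom ≫ whiskerLeft (onComplexes F) β ≫
      (Functor.associator _ _ _).inv) L ≫ (Functor.associator _ _ _).hom ≫
      whiskerLeft (onComplexes F ⋙ Q) adj'.counit ≫ (rightUnitor _).hom := by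
    ext X
    have h1 : _ ≫ adj'.counit.app (Q.obj ((onComplexes F).obj X)) = _ :=
      hadj.2 ((onComplexes F).obj X)
    have h2 : L.map (Q.map ((adjOnComplexes adj).unit.app X)) ≫ α.app _ = _ ≫ Q.map _ :=
      α.naturality ((adjOnComplexes adj).unit.app X)
    have h3 := (adjOnComplexes adj).left_triangle_components X
    simp [h1]
    rw [reassoc_of% h2, ← Q.map_comp, h3, Q.map_id, Category.comp_id]
  rw [h]
  have : NatTrans.CommShift β ℤ := inferInstanceAs
    (NatTrans.CommShift G.mapDerivedCategoryFactors.inv ℤ)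
  infer_instance

theorem hasRightDerivedAdjunction [EnoughInjectives C] [HasLimitsOfShape (Discrete ℤ) C]
    [HasLimitsOfShape (Discrete ℕ) C] [HasExactLimitsOfShape (Discrete ℕ) C]
    {G : D ⥤ C} {F : C ⥤ D} [F.Additive] [G.Additive]
    [PreservesFiniteLimits G] [PreservesFiniteColimits G] (adj : G ⊣ F) :
    HasRightDerivedAdjunction adj := by
  have hP := rightResolving_isKInjective (C := C)
  have hF := onComplexes_Q_map_eq_of_isKInjective F
  have := hP.hasPointwiseRightDerivedFunctor _ hF
  refine ⟨inferInstance, fun R β hβ => ?_⟩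
  have hβ' := hP.isIso_app _ hF β
  let G' := G.mapDerivedCategory
  let α : Q ⋙ G' ⟶ onComplexes G ⋙ Q := G.mapDerivedCategoryFactors.hom
  have : G'.IsLeftDerivedFunctor α (qis D) :=
    isLeftDerivedFunctor_of_inverts (qis D) G' G.mapDerivedCategoryFactors
  have : (R ⋙ G').IsRightDerivedFunctor
      (whiskerRight β G' ≫ (Functor.associator _ _ _).hom) (qis C) :=
    hP.isRightDerivedFunctor _ fun Y hY => by
      have := hβ' Y hY
      simp only [NatTrans.comp_app, associator_hom_app, whiskerRight_app]
      infer_instance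
  have : (G' ⋙ R).IsLeftDerivedFunctor
      ((Functor.associator _ _ _).inv ≫ whiskerRight α R) (qis D) :=
    isLeftDerivedFunctor_of_inverts (qis D) (G' ⋙ R)
      ((Functor.associator _ _ _).symm ≪≫ isoWhiskerRight G.mapDerivedCategoryFactors R)
  let adj' : G' ⊣ R := (adjOnComplexes adj).derived (qis D) (qis C) α β
  have hadj : IsDerivedAdjunction (adjOnComplexes adj) α β adj' :=
    ⟨fun X => (adjOnComplexes adj).derivedη_fac_app (qis D) α β X,
      fun Y => (adjOnComplexes adj).derivedε_fac_app (qis C) α β Y⟩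
  let := adj'.rightAdjointCommShift ℤ
  have hs := adj'.commShift_of_leftAdjoint ℤ
  have ht := adj'.isTriangulated_rightAdjoint
  refine ⟨inferInstance, adj', ht, ?_, hs, hadj⟩
  -- Dually, `β` is the mate of `α`, so it inherits compatibility with shifts.
  have h : β = (rightUnitor _).inv ≫ whiskerLeft (onComplexes F ⋙ Q) adj'.unit ≫
      (Functor.associator _ _ _).inv ≫ whiskerRight ((Functor.associator _ _ _).hom ≫
        whiskerLeft (onComplexes F) α ≫ (Functor.associator _ _ _).inv ≫
        whiskerRight (adjOnComplexes adj).counit Q ≫ Q.leftUnitor.hom) R := by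
    ext X
    have h1 : adj'.unit.app (Q.obj ((onComplexes F).obj X)) ≫ R.map (α.app _) = _ :=
      hadj.1 ((onComplexes F).obj X)
    have h2 : Q.map _ ≫ β.app X = β.app ((onComplexes G).obj ((onComplexes F).obj X)) ≫
        R.map (Q.map ((adjOnComplexes adj).counit.app X)) :=
      β.naturality ((adjOnComplexes adj).counit.app X)
    have h3 := (adjOnComplexes adj).right_triangle_components X
    simp [reassoc_of% h1]
    rw [← h2, ← Q.map_comp_assoc, h3, Q.map_id, Category.id_comp]
  rw [h]
  have : NatTrans.CommShift α ℤ := inferInstanceAs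
    (NatTrans.CommShift G.mapDerivedCategoryFactors.hom ℤ)
  infer_instance

end DerivedAdjunctions
-- Enough projectives and injectives for representations.
section Representations

variable (A : Type u) [CommRing A] (G : Type u) [Group G]

/-- Representations of `G`, as functors on `BG`, are modules over the group algebra. -/
noncomputable def equivalenceModuleMonoidAlgebra :
    RepCat A G ≌ ModuleCat.{u} (MonoidAlgebra A G) :=
  (repEquiv A G).symm.trans Rep.equivalenceModuleMonoidAlgebra

instance : EnoughProjectives (RepCat A G) :=
  (equivalenceModuleMonoidAlgebra A G).enoughProjectives_iff.2 inferInstance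

instance : EnoughInjectives (RepCat A G) :=
  (equivalenceModuleMonoidAlgebra A G).enoughInjectives_iff.2 inferInstance

end Representations

/-! ### Comparison of derived functors of isomorphic functors. -/

section Comparison

open Functor DerivedCategory

variable {C D : Type*} [Category* C] [Category* D] [Abelian C] [Abelian D]
  [HasDerivedCategory.{w₁} C] [HasDerivedCategory.{w₂} D]

/-- The functor induced by an exact functor is a left derived functor of it, so uniqueness of left
derived functors applies. -/
theorem exists_mapDerivedCategory_iso {F G : C ⥤ D} [F.Additive] [G.Additive]
    [PreservesFiniteLimits F] [PreservesFiniteColimits F]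
    [PreservesFiniteLimits G] [PreservesFiniteColimits G] (e : F ≅ G) :
    ∃ ρ : F.mapDerivedCategory ≅ G.mapDerivedCategory,
      ∀ X, ρ.hom.app (Q.obj X) ≫ G.mapDerivedCategoryFactors.hom.app X =
        F.mapDerivedCategoryFactors.hom.app X ≫ Q.map ((isoOnComplexes e).hom.app X) := by
  have := isLeftDerivedFunctor_of_inverts (qis C) F.mapDerivedCategory F.mapDerivedCategoryFactors
  have := isLeftDerivedFunctor_of_inverts (qis C) G.mapDerivedCategory G.mapDerivedCategoryFactors
  exact ⟨leftDerivedNatIso _ _ F.mapDerivedCategoryFactors.hom G.mapDerivedCategoryFactors.hom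
    (qis C) (isoWhiskerRight (isoOnComplexes e) Q), fun X => leftDerivedNatTrans_app _ _ _ _ (qis C) _ X⟩

theorem exists_leftDerived_iso {F F' : C ⥤ D} [F.Additive] [F'.Additive] (e : F ≅ F')
    (L L' : DerivedCategory C ⥤ DerivedCategory D) (α : Q ⋙ L ⟶ onComplexes F ⋙ Q)
    (α' : Q ⋙ L' ⟶ onComplexes F' ⋙ Q) [L.IsLeftDerivedFunctor α (qis C)]
    [L'.IsLeftDerivedFunctor α' (qis C)] :
    ∃ θ : L ≅ L', ∀ X, θ.hom.app (Q.obj X) ≫ α'.app X =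
      α.app X ≫ Q.map ((isoOnComplexes e).hom.app X) :=
  ⟨leftDerivedNatIso L L' α α' (qis C) (isoWhiskerRight (isoOnComplexes e) Q),
    fun X => leftDerivedNatTrans_app _ _ _ _ (qis C) _ X⟩

theorem exists_rightDerived_iso {F F' : C ⥤ D} [F.Additive] [F'.Additive] (e : F ≅ F')
    (R R' : DerivedCategory C ⥤ DerivedCategory D) (β : onComplexes F ⋙ Q ⟶ Q ⋙ R)
    (β' : onComplexes F' ⋙ Q ⟶ Q ⋙ R') [R.IsRightDerivedFunctor β (qis C)]
    [R'.IsRightDerivedFunctor β' (qis C)] :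
    ∃ θ : R ≅ R', ∀ X, β.app X ≫ θ.hom.app (Q.obj X) =
      Q.map ((isoOnComplexes e).hom.app X) ≫ β'.app X :=
  ⟨rightDerivedNatIso R R' β β' (qis C) (isoWhiskerRight (isoOnComplexes e) Q),
    fun X => rightDerivedNatTrans_app _ _ _ _ (qis C) _ X⟩

end Comparison

end DerivedFrobenius

theorem mainTheorem9 (A : Type u) [CommRing A] (H G : Type u) [Group H] [Group G] (φ : H →* G)
    [HasDerivedCategory.{w₁} (DerivedFrobenius.RepCat A H)]
    [HasDerivedCategory.{w₂} (DerivedFrobenius.RepCat A G)] :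
    -- the chain of adjunctions `L Bφ_! ⊣ Bφ^* ⊣ R Bφ_*`
    DerivedFrobenius.HasLeftDerivedAdjunction (DerivedFrobenius.BshriekAdj A φ) ∧
    DerivedFrobenius.HasRightDerivedAdjunction (DerivedFrobenius.BstarAdj A φ) ∧
    -- the chain of adjunctions `L Ind ⊣ φ^# ⊣ R CoInd`
    DerivedFrobenius.HasLeftDerivedAdjunction (DerivedFrobenius.indAdj A φ) ∧
    DerivedFrobenius.HasRightDerivedAdjunction (DerivedFrobenius.coindAdj A φ) ∧
    -- `Bφ^* = φ^#` on derived categories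
    (∃ ρ : (DerivedFrobenius.Bpull A φ).mapDerivedCategory ≅
        (DerivedFrobenius.Res A φ).mapDerivedCategory,
      ∀ X, ρ.hom.app (DerivedCategory.Q.obj X) ≫
          (DerivedFrobenius.Res A φ).mapDerivedCategoryFactors.hom.app X =
        (DerivedFrobenius.Bpull A φ).mapDerivedCategoryFactors.hom.app X ≫
          DerivedCategory.Q.map
            ((DerivedFrobenius.isoOnComplexes (DerivedFrobenius.resIso A φ)).hom.app X)) ∧
    -- `Bφ_! = Ind` through the adjunctions with restriction, and `L Bφ_! = L Ind`
    (∃ e : DerivedFrobenius.Bshriek A φ ≅ DerivedFrobenius.Ind A φ,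
      conjugateEquiv (DerivedFrobenius.BshriekAdj A φ) (DerivedFrobenius.indAdj A φ) e.inv =
        (DerivedFrobenius.resIso A φ).hom ∧
      ∀ (L L' : DerivedCategory (DerivedFrobenius.RepCat A H) ⥤
            DerivedCategory (DerivedFrobenius.RepCat A G))
        (α : DerivedCategory.Q ⋙ L ⟶
          DerivedFrobenius.onComplexes (DerivedFrobenius.Bshriek A φ) ⋙ DerivedCategory.Q)
        (α' : DerivedCategory.Q ⋙ L' ⟶
          DerivedFrobenius.onComplexes (DerivedFrobenius.Ind A φ) ⋙ DerivedCategory.Q),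
        L.IsLeftDerivedFunctor α (DerivedFrobenius.qis _) →
        L'.IsLeftDerivedFunctor α' (DerivedFrobenius.qis _) →
        ∃ θ : L ≅ L', ∀ X, θ.hom.app (DerivedCategory.Q.obj X) ≫ α'.app X =
          α.app X ≫ DerivedCategory.Q.map ((DerivedFrobenius.isoOnComplexes e).hom.app X)) ∧
    -- `Bφ_* = CoInd` through the adjunctions with restriction, and `R Bφ_* = R CoInd`
    (∃ e : DerivedFrobenius.Bstar A φ ≅ DerivedFrobenius.CoInd A φ,
      conjugateEquiv (DerivedFrobenius.BstarAdj A φ) (DerivedFrobenius.coindAdj A φ)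
          (DerivedFrobenius.resIso A φ).inv = e.hom ∧
      ∀ (R R' : DerivedCategory (DerivedFrobenius.RepCat A H) ⥤
            DerivedCategory (DerivedFrobenius.RepCat A G))
        (β : DerivedFrobenius.onComplexes (DerivedFrobenius.Bstar A φ) ⋙ DerivedCategory.Q ⟶
          DerivedCategory.Q ⋙ R)
        (β' : DerivedFrobenius.onComplexes (DerivedFrobenius.CoInd A φ) ⋙ DerivedCategory.Q ⟶
          DerivedCategory.Q ⋙ R'),
        R.IsRightDerivedFunctor β (DerivedFrobenius.qis _) →
        R'.IsRightDerivedFunctor β' (DerivedFrobenius.qis _) →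
        ∃ θ : R ≅ R', ∀ X, β.app X ≫ θ.hom.app (DerivedCategory.Q.obj X) =
          DerivedCategory.Q.map ((DerivedFrobenius.isoOnComplexes e).hom.app X) ≫
            β'.app X) := by
  -- Conjugation reverses direction: `e₁` goes from `Ind` to `Bshriek` and is inverted below, while
  -- `e₂` has to start from the inverse of `resIso`.
  let e₁ := (conjugateIsoEquiv (DerivedFrobenius.BshriekAdj A φ)
    (DerivedFrobenius.indAdj A φ)).symm (DerivedFrobenius.resIso A φ)
  let e₂ := conjugateIsoEquiv (DerivedFrobenius.BstarAdj A φ)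
    (DerivedFrobenius.coindAdj A φ) (DerivedFrobenius.resIso A φ).symm
  refine ⟨DerivedFrobenius.hasLeftDerivedAdjunction _,
    DerivedFrobenius.hasRightDerivedAdjunction _, DerivedFrobenius.hasLeftDerivedAdjunction _,
    DerivedFrobenius.hasRightDerivedAdjunction _,
    DerivedFrobenius.exists_mapDerivedCategory_iso _, ⟨e₁.symm, ?_, ?_⟩, ⟨e₂, ?_, ?_⟩⟩
  · exact (conjugateEquiv (DerivedFrobenius.BshriekAdj A φ)
      (DerivedFrobenius.indAdj A φ)).apply_symm_apply _
  · intro L L' α α' _ _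
    exact DerivedFrobenius.exists_leftDerived_iso _ L L' α α'
  · rfl
  · intro R R' β β' _ _
    exact DerivedFrobenius.exists_rightDerived_iso _ R R' β β'
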